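/- A state of one mode (or of two modes) is a density operator, given by its matrix in the Fock basis $|n\rangle$, $n\in\mathbb N_0$ (respectively $|m,n\rangle$): a positive semidefinite matrix of unit trace. Its matrix is number-diagonal if all its off-diagonal entries in the Fock basis vanish. For $r\in\mathbb C$ let $|r\rangle=e^{-|r|^2/2}\sum_n \frac{r^n}{\sqrt{n!}}|n\rangle$ be the coherent state; the Husimi function of a one-mode state $\rho$ is $Q_\rho(r)=\frac1\pi\langle r|\rho|r\rangle$. Let $x,y$ be the annihilation operators of two modes and let $0<\eta<1$. The beamsplitter of transmissivity $\eta$ is the unitary $U$ with $U|0,0\rangle=|0,0\rangle$, $Ux^\dagger U^\dagger=\sqrt\eta\,x^\dagger-\sqrt{1-\eta}\,y^\dagger$ and $Uy^\dagger U^\dagger=\sqrt{1-\eta}\,x^\dagger+\sqrt\eta\,y^\dagger$, i.e. with output mode $z=U^\dagger xU=\sqrt\eta\,x+\sqrt{1-\eta}\,y$. For input states $\rho^X,\rho^Y$, the state of the output mode is $\rho^Z=\mathrm{Tr}_2\bigl(U(\rho^X\otimes\rho^Y)U^\dagger\bigr)$, where $\mathrm{Tr}_2$ is the partial trace over the second mode.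 For a p.m.f. $p$ on $\mathbb N_0$ and an integrable $f:\mathbb C\to\mathbb R$ put $$\mathcal T(p)(r)=\frac1\pi\sum_{n\ge0}p[n]\frac{e^{-|r|^2}|r|^{2n}}{n!},\qquad \mathcal T^{-1}(f)[n]=\frac1\pi\int_{\mathbb C}\mathcal L_n(|s|^2)\Bigl(\int_{\mathbb C} f(r)\,e^{rs^*-r^*s}\,d^2r\Bigr)d^2s,$$ where $\mathcal L_n$ is the $n$-th Laguerre polynomial. For independent $\mathbb N_0$-valued $X,Y$ with p.m.f.s $p_X,p_Y$, the distribution of $X\boxplus_\eta Y$ is $\mathcal T^{-1}$ of the p.d.f. of $\sqrt\eta\,X_c+\sqrt{1-\eta}\,Y_c$, where $X_c,Y_c$ are independent complex random variables with p.d.f.s $\mathcal T(p_X),\mathcal T(p_Y)$. **Theorem.** Let $0<\eta<1$. 1. For all p.m.f.s $p_X,p_Y$ on $\mathbb N_0$, mixing $\rho^X=\sum_n p_X[n]|n\rangle\langle n|$ and $\rho^Y=\sum_n p_Y[n]|n\rangle\langle n|$ on the beamsplitter gives a number-diagonal output $\rho^Z=\sum_n p_Z[n]|n\rangle\langle n|$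 with $p_Z$ a p.m.f., and $p_Z$ is the distribution of $X\boxplus_\eta Y$ (the outer integrals defining it being absolutely convergent). Moreover $\mathcal T(p_Z)$ is a p.d.f. of $\sqrt\eta\,X_c+\sqrt{1-\eta}\,Y_c$. 2. $U$ is indeed unitary, and $xU=U(\sqrt\eta\,x+\sqrt{1-\eta}\,y)$ on vectors with finitely many photons. 3. For every p.m.f. $p$ on $\mathbb N_0$, $\sum_n p[n]|n\rangle\langle n|$ is a state whose Husimi function is $\mathcal T(p)$, and $\mathcal T^{-1}(\mathcal T(p))=p$, the outer integrals being absolutely convergent. 4. The Husimi function $Q_\rho$ of every one-mode state $\rho$ is a well-defined p.d.f. on $\mathbb C$ (the double series for $\langle r|\rho|r\rangle$ in the Fock basis converges absolutely, to a real number), and $Q_\rho$ is circularly symmetric if and only if $\rho$ is number-diagonal. 5. For all one-mode states $\rho^X,\rho^Y$, $U(\rho^X\otimes\rho^Y)U^\dagger$ and $\rho^Z$ are states, and Husimi functions combine by scaled convolution: for every $r\in\mathbb C$, $$Q_{\rho^Z}(r)=\int_{\mathbb C}\frac1\eta\,Q_{\rho^X}\!\Bigl(\frac{t}{\sqrt\eta}\Bigr)\,\frac1{1-\eta}\,Q_{\rho^Y}\!\Bigl(\frac{r-t}{\sqrt{1-\eta}}\Bigr)\,d^2t,$$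 the integral being absolutely convergent. -/

import Mathlib

open MeasureTheory
open scoped ComplexConjugate ComplexOrder Matrix Kronecker Nat Convolution

noncomputable section

namespace NumberMixing

/-! ### States as matrices in the Fock basis

A mode has Fock basis `|n⟩`, `n : ℕ`; a pair of modes has Fock basis `|m, n⟩`, `(m, n) : ℕ × ℕ`.
A state is given by its matrix elements in that basis. -/

/-- A density operator: a positive semidefinite (in particular Hermitian) infinite matrix of unit
trace. Positivity and summability of the diagonal make such a matrix the matrix of a positive
trace-class operator on `ℓ²(ι)`, and conversely. -/
def IsDensity {ι : Type*} (ρ : Matrix ι ι ℂ) : Prop :=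
  ρ.PosSemidef ∧ HasSum (fun i => ρ i i) 1

/-- The number-diagonal state `∑ₙ p[n] |n⟩⟨n|`. -/
def numberDiag (p : PMF ℕ) : Matrix ℕ ℕ ℂ :=
  Matrix.diagonal fun n => (((p n).toReal : ℝ) : ℂ)

/-- The product of two infinite matrices. -/
def imul {ι κ ν : Type*} (A : Matrix ι κ ℂ) (B : Matrix κ ν ℂ) : Matrix ι ν ℂ :=
  fun i k => ∑' j, A i j * B j k

/-- The partial trace over the second of two modes. -/
def partialTrace (T : Matrix (ℕ × ℕ) (ℕ × ℕ) ℂ) : Matrix ℕ ℕ ℂ :=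
  fun j j' => ∑' k, T (j, k) (j', k)

/-! ### The beamsplitter -/

/-- Two-mode vectors with finitely many photons: the linear span of the `|m, n⟩`. -/
abbrev TwoMode : Type := (ℕ × ℕ) →₀ ℂ

/-- The basis vector `|m, n⟩`. -/
def ket (a : ℕ × ℕ) : TwoMode := Finsupp.single a 1

/-- The annihilation operator of the first mode, `x |m, n⟩ = √m |m - 1, n⟩`. -/
def annX : Module.End ℂ TwoMode :=
  Finsupp.linearCombination ℂ fun a : ℕ × ℕ => ((√(a.1 : ℝ) : ℝ) : ℂ) • ket (a.1 - 1, a.2)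

/-- The annihilation operator of the second mode, `y |m, n⟩ = √n |m, n - 1⟩`. -/
def annY : Module.End ℂ TwoMode :=
  Finsupp.linearCombination ℂ fun a : ℕ × ℕ => ((√(a.2 : ℝ) : ℝ) : ℂ) • ket (a.1, a.2 - 1)

/-- The creation operator of the first mode, `x† |m, n⟩ = √(m + 1) |m + 1, n⟩`. -/
def creX : Module.End ℂ TwoMode :=
  Finsupp.linearCombination ℂ fun a : ℕ × ℕ => ((√(a.1 + 1 : ℝ) : ℝ) : ℂ) • ket (a.1 + 1, a.2)

/-- The creation operator of the second mode, `y† |m, n⟩ = √(n + 1) |m, n + 1⟩`. -/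
def creY : Module.End ℂ TwoMode :=
  Finsupp.linearCombination ℂ fun a : ℕ × ℕ => ((√(a.2 + 1 : ℝ) : ℝ) : ℂ) • ket (a.1, a.2 + 1)

/-- The beamsplitter of transmissivity `η`, in the Schrödinger picture: `|0, 0⟩` is fixed, and
`U x† U† = √η x† - √(1 - η) y†`, `U y† U† = √(1 - η) x† + √η y†`. Equivalently, in the Heisenberg
picture, the first output mode is `U† x U = √η x + √(1 - η) y`. -/
def beamsplitter (η : ℝ) : Module.End ℂ TwoMode :=
  Finsupp.linearCombination ℂ fun a : ℕ × ℕ =>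
    (((1 / √((a.1 ! : ℝ) * (a.2 ! : ℝ)) : ℝ)) : ℂ) •
      (((((√η : ℝ) : ℂ) • creX - ((√(1 - η) : ℝ) : ℂ) • creY) ^ a.1 *
        (((√(1 - η) : ℝ) : ℂ) • creX + ((√η : ℝ) : ℂ) • creY) ^ a.2) (ket (0, 0)))

/-- The matrix of the beamsplitter, `⟨a| U |b⟩`. -/
def bsMatrix (η : ℝ) : Matrix (ℕ × ℕ) (ℕ × ℕ) ℂ :=
  fun a b => beamsplitter η (ket b) a

/-- The joint state `U (ρX ⊗ ρY) U†` of the two output modes, for independent inputs. -/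
def jointOutput (η : ℝ) (ρX ρY : Matrix ℕ ℕ ℂ) : Matrix (ℕ × ℕ) (ℕ × ℕ) ℂ :=
  imul (imul (bsMatrix η) (ρX ⊗ₖ ρY)) (bsMatrix η)ᴴ

/-- The state `ρZ` of the output mode `z = √η x + √(1 - η) y`. -/
def output (η : ℝ) (ρX ρY : Matrix ℕ ℕ ℂ) : Matrix ℕ ℕ ℂ :=
  partialTrace (jointOutput η ρX ρY)

/-! ### Husimi functions -/

/-- The coherent state `|r⟩ = e^{-|r|²/2} ∑ₙ rⁿ / √(n!) |n⟩`. -/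
def coherent (r : ℂ) (n : ℕ) : ℂ :=
  ((Real.exp (-‖r‖ ^ 2 / 2) / √(n ! : ℝ) : ℝ) : ℂ) * r ^ n

/-- The terms of the double series for `⟨r| ρ |r⟩`. -/
def husimiTerm (ρ : Matrix ℕ ℕ ℂ) (r : ℂ) (a : ℕ × ℕ) : ℂ :=
  conj (coherent r a.1) * ρ a.1 a.2 * coherent r a.2

/-- The Husimi function `r ↦ ⟨r| ρ |r⟩ / π`. -/
def husimi (ρ : Matrix ℕ ℕ ℂ) (r : ℂ) : ℝ :=
  (1 / Real.pi) * (∑' a : ℕ × ℕ, husimiTerm ρ r a).re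

/-- A function on the plane that depends on the modulus only. -/
def CircularlySymmetric (f : ℂ → ℝ) : Prop :=
  ∀ u r : ℂ, ‖u‖ = 1 → f (u * r) = f r

/-- `r ↦ t⁻¹ f (r / √t)`: the p.d.f. of `√t Xc` when `f` is that of `Xc`. -/
def scaleDensity (t : ℝ) (f : ℂ → ℝ) (r : ℂ) : ℝ :=
  (1 / t) * f (r / ((√t : ℝ) : ℂ))

/-! ### The transform `𝒯` and the scaled addition of distributions on `ℕ` -/

/-- The Laguerre polynomial `Lₙ`. -/
def laguerre (n : ℕ) (x : ℝ) : ℝ :=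
  ∑ k ∈ Finset.range (n + 1), (-1) ^ k * (n.choose k : ℝ) * x ^ k / (k ! : ℝ)

/-- The transform `𝒯` from a p.m.f. on `ℕ` to a p.d.f. on `ℂ`. -/
def transform (p : PMF ℕ) (r : ℂ) : ℝ :=
  (1 / Real.pi) * ∑' n : ℕ, (p n).toReal * (Real.exp (-‖r‖ ^ 2) * ‖r‖ ^ (2 * n) / (n ! : ℝ))

/-- The inner integral `∫ f(r) e^{r s* - r* s} d²r` of the inverse transform. -/
def charFn (f : ℂ → ℝ) (s : ℂ) : ℂ :=
  ∫ r : ℂ, (f r : ℂ) * Complex.exp (r * conj s - conj r * s)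

/-- The integrand, as a function of `s`, of the inverse transform. -/
def invIntegrand (f : ℂ → ℝ) (n : ℕ) (s : ℂ) : ℂ :=
  ((laguerre n (‖s‖ ^ 2) : ℝ) : ℂ) * charFn f s

/-- The inverse transform
`𝒯⁻¹(f)[n] = π⁻¹ ∫∫ f(r) Lₙ(|s|²) e^{r s* - r* s} d²r d²s`, with the integral over `r` inside. -/
def invTransform (f : ℂ → ℝ) (n : ℕ) : ℂ :=
  (1 / (Real.pi : ℂ)) * ∫ s : ℂ, invIntegrand f n s

/-- The law on `ℂ` with p.d.f. `f`. -/
def lawOf (f : ℂ → ℝ) : Measure ℂ :=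
  (volume : Measure ℂ).withDensity fun r => ENNReal.ofReal (f r)

/-- The law of `√η Xc + √(1 - η) Yc` for independent `Xc`, `Yc` with laws `μ`, `ν`. -/
def scaledAddLaw (η : ℝ) (μ ν : Measure ℂ) : Measure ℂ :=
  (μ.prod ν).map fun a => ((√η : ℝ) : ℂ) * a.1 + ((√(1 - η) : ℝ) : ℂ) * a.2

/-- The p.d.f. of `√η Xc + √(1 - η) Yc` for independent `Xc`, `Yc` with p.d.f.s `f`, `g`. -/
def scaledAddDensity (η : ℝ) (f g : ℂ → ℝ) (r : ℂ) : ℝ :=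
  ((scaledAddLaw η (lawOf f) (lawOf g)).rnDeriv volume r).toReal

/-- The distribution of `X ⊞_η Y = 𝒯⁻¹(𝒯(X) ⊞_η 𝒯(Y))` for independent `X`, `Y` with p.m.f.s
`p`, `q`. -/
def boxplus (η : ℝ) (p q : PMF ℕ) : ℕ → ℂ :=
  invTransform (scaledAddDensity η (transform p) (transform q))

end NumberMixing

end

open NumberMixing

/-! ### Operator algebra of the beamsplitter on finite-photon vectors. -/

namespace NumberMixing

/-! ### Creation and annihilation operators -/

/-! The beamsplitter rotates the two creation operators. Since creation operators generate
everything from the vacuum, identities for it follow by checking the vacuum and comparing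
commutators. This yields the action on annihilation operators, preservation of the pairing
(`pairing_beamsplitter`) and conservation of photon number (`bsMatrix_eq_zero`). Every infinite
matrix product then reduces to finite blocks, where an isometry is unitary.

In the Bargmann representation creation is multiplication by a variable, so the beamsplitter is a
rotation of variables and its adjoint sends the coherent state `|r, s⟩` to the rotated one
(`sum_bsMatrix_coherent₂`). The expectation of the joint output in `|r, s⟩` is therefore a product
of values of the two input Husimi functions (`tsum_quadTerm_jointOutput`). Integrating over `s`
traces out the second mode by the resolution of the identity (`lintegral_husimi`), and a linear
substitution turns the integral into a scaled convolution (`husimi_output`).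

In polar coordinates the angular Fourier coefficients of a Husimi function are power series built
from the diagonals of the matrix. The coefficient of order zero gives the total mass; the others all
vanish exactly for number-diagonal states.

Conservation of photon number makes the output of number-diagonal inputs number-diagonal. As `𝒯(p)`
is the Husimi function of the diagonal state, the convolution formula says that `𝒯(p_Z)` is the
density of the scaled sum, and it remains to invert `𝒯`. The characteristic function of a number
state is a Gaussian times a Laguerre polynomial (`charFn_numberHusimi`), so the inversion is
Laguerre orthogonality in the plane (`invTransform_transform`). -/

theorem annX_ket (a : ℕ × ℕ) : annX (ket a) = ((√(a.1 : ℝ) : ℝ) : ℂ) • ket (a.1 - 1, a.2) := by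
  simp [annX, ket]

theorem annY_ket (a : ℕ × ℕ) : annY (ket a) = ((√(a.2 : ℝ) : ℝ) : ℂ) • ket (a.1, a.2 - 1) := by
  simp [annY, ket]

theorem creX_ket (a : ℕ × ℕ) :
    creX (ket a) = ((√(a.1 + 1 : ℝ) : ℝ) : ℂ) • ket (a.1 + 1, a.2) := by
  simp [creX, ket]

theorem creY_ket (a : ℕ × ℕ) :
    creY (ket a) = ((√(a.2 + 1 : ℝ) : ℝ) : ℂ) • ket (a.1, a.2 + 1) := by
  simp [creY, ket]

theorem end_ext {f g : Module.End ℂ TwoMode} (h : ∀ a, f (ket a) = g (ket a)) : f = g := by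
  refine Finsupp.lhom_ext' fun a => LinearMap.ext_ring ?_
  exact h a

theorem ofReal_sqrt_mul_self {x : ℝ} (hx : 0 ≤ x) : ((√x : ℝ) : ℂ) * ((√x : ℝ) : ℂ) = (x : ℂ) := by
  rw [← Complex.ofReal_mul, Real.mul_self_sqrt hx]

theorem creX_mul_creY : creX * creY = creY * creX := by
  refine end_ext fun a => ?_
  simp [creX_ket, creY_ket, smul_smul, mul_comm]

theorem annX_mul_creX : annX * creX = creX * annX + 1 := by
  refine end_ext fun ⟨m, n⟩ => ?_
  rcases m with _ | m
  · simp [creX_ket, annX_ket]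
  · have h1 := ofReal_sqrt_mul_self (show (0 : ℝ) ≤ (m : ℝ) + 1 + 1 by positivity)
    have h2 := ofReal_sqrt_mul_self (show (0 : ℝ) ≤ (m : ℝ) + 1 by positivity)
    simp only [Module.End.mul_apply, LinearMap.add_apply, Module.End.one_apply, creX_ket, annX_ket,
      map_smul, smul_smul, Nat.cast_add, Nat.cast_one, add_tsub_cancel_right, h1, h2]
    push_cast
    module

theorem annY_mul_creY : annY * creY = creY * annY + 1 := by
  refine end_ext fun ⟨m, n⟩ => ?_
  rcases n with _ | n
  · simp [creY_ket, annY_ket]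
  · have h1 := ofReal_sqrt_mul_self (show (0 : ℝ) ≤ (n : ℝ) + 1 + 1 by positivity)
    have h2 := ofReal_sqrt_mul_self (show (0 : ℝ) ≤ (n : ℝ) + 1 by positivity)
    simp only [Module.End.mul_apply, LinearMap.add_apply, Module.End.one_apply, creY_ket, annY_ket,
      map_smul, smul_smul, Nat.cast_add, Nat.cast_one, add_tsub_cancel_right, h1, h2]
    push_cast
    module

theorem annX_mul_creY : annX * creY = creY * annX := by
  refine end_ext fun a => ?_
  simp [annX_ket, creY_ket, smul_smul, mul_comm]

theorem annY_mul_creX : annY * creX = creX * annY := by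
  refine end_ext fun a => ?_
  simp [annY_ket, creX_ket, smul_smul, mul_comm]

theorem ofReal_sqrt_succ_ne_zero (m : ℕ) : ((√((m : ℝ) + 1) : ℝ) : ℂ) ≠ 0 := by
  rw [Ne, Complex.ofReal_eq_zero, Real.sqrt_eq_zero']
  push Not
  positivity

theorem ket_succ_fst (m n : ℕ) :
    ket (m + 1, n) = (((√((m : ℝ) + 1) : ℝ) : ℂ))⁻¹ • creX (ket (m, n)) := by
  rw [creX_ket, smul_smul, inv_mul_cancel₀ (ofReal_sqrt_succ_ne_zero m), one_smul]

theorem ket_succ_snd (m n : ℕ) :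
    ket (m, n + 1) = (((√((n : ℝ) + 1) : ℝ) : ℂ))⁻¹ • creY (ket (m, n)) := by
  rw [creY_ket, smul_smul, inv_mul_cancel₀ (ofReal_sqrt_succ_ne_zero n), one_smul]

theorem number_induction {P : ℕ × ℕ → Prop} (h0 : P (0, 0)) (hX : ∀ m n, P (m, n) → P (m + 1, n))
    (hY : ∀ m n, P (m, n) → P (m, n + 1)) (a : ℕ × ℕ) : P a := by
  obtain ⟨m, n⟩ := a
  induction m with
  | zero =>
    induction n with
    | zero => exact h0
    | succ n ih => exact hY _ _ ih
  | succ m ih => exact hX _ _ ih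

/-- The vacuum generates the finite-photon vectors under the two creation operators. -/
theorem mem_of_creation_closed {p : Submodule ℂ TwoMode} (h0 : ket (0, 0) ∈ p)
    (hX : ∀ v ∈ p, creX v ∈ p) (hY : ∀ v ∈ p, creY v ∈ p) (v : TwoMode) : v ∈ p := by
  have hk : ∀ a, ket a ∈ p := number_induction h0
    (fun m n h => by rw [ket_succ_fst]; exact p.smul_mem _ (hX _ h))
    (fun m n h => by rw [ket_succ_snd]; exact p.smul_mem _ (hY _ h))
  induction v using Finsupp.induction_linear with
  | zero => exact p.zero_mem
  | add f g hf hg => exact p.add_mem hf hg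
  | single a c =>
    have : Finsupp.single a c = c • ket a := by simp [ket]
    rw [this]
    exact p.smul_mem _ (hk a)

/-- At zero photons the factor `√0` cancels the spurious value produced by truncated subtraction, so
one formula covers all indices. -/
theorem creX_apply (v : TwoMode) (a : ℕ × ℕ) :
    creX v a = ((√(a.1 : ℝ) : ℝ) : ℂ) * v (a.1 - 1, a.2) := by
  induction v using Finsupp.induction_linear with
  | zero => simp
  | add f g hf hg => simp [hf, hg, mul_add]
  | single b c =>
    obtain ⟨m, n⟩ := a
    obtain ⟨k, l⟩ := b
    have : Finsupp.single (k, l) c = c • ket (k, l) := by simp [ket]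
    rw [this, map_smul, creX_ket]
    rcases m with _ | m
    · simp [ket]
    · by_cases h : k = m ∧ l = n
      · obtain ⟨rfl, rfl⟩ := h
        simp [ket, mul_comm]
      · have h1 : ¬ ((k, l) = (m, n)) := by simpa using h
        have h2 : ¬ ((k + 1, l) = (m + 1, n)) := by simpa using h
        simp [ket, h]

theorem creY_apply (v : TwoMode) (a : ℕ × ℕ) :
    creY v a = ((√(a.2 : ℝ) : ℝ) : ℂ) * v (a.1, a.2 - 1) := by
  induction v using Finsupp.induction_linear with
  | zero => simp
  | add f g hf hg => simp [hf, hg, mul_add]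
  | single b c =>
    obtain ⟨m, n⟩ := a
    obtain ⟨k, l⟩ := b
    have : Finsupp.single (k, l) c = c • ket (k, l) := by simp [ket]
    rw [this, map_smul, creY_ket]
    rcases n with _ | n
    · simp [ket]
    · by_cases h : k = m ∧ l = n
      · obtain ⟨rfl, rfl⟩ := h
        simp [ket, mul_comm]
      · simp [ket, h]

/-! ### Intertwining relations of the beamsplitter -/

/-- The image `U x† U†` of the first creation operator. -/
noncomputable def creXOut (η : ℝ) : Module.End ℂ TwoMode :=
  ((√η : ℝ) : ℂ) • creX - ((√(1 - η) : ℝ) : ℂ) • creY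

/-- The image `U y† U†` of the second creation operator. -/
noncomputable def creYOut (η : ℝ) : Module.End ℂ TwoMode :=
  ((√(1 - η) : ℝ) : ℂ) • creX + ((√η : ℝ) : ℂ) • creY

theorem beamsplitter_ket (η : ℝ) (a : ℕ × ℕ) :
    beamsplitter η (ket a) = (((1 / √((a.1 ! : ℝ) * (a.2 ! : ℝ)) : ℝ)) : ℂ) •
      (creXOut η ^ a.1 * creYOut η ^ a.2) (ket (0, 0)) := by
  simp [beamsplitter, ket, creXOut, creYOut]

theorem beamsplitter_vacuum (η : ℝ) : beamsplitter η (ket (0, 0)) = ket (0, 0) := by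
  simp [beamsplitter_ket]

/-- Needed for `beamsplitter_mul_creY`: an extra second-mode factor must cross the first-mode powers
standing to its left in `beamsplitter_ket`. -/
theorem creXOut_commute_creYOut (η : ℝ) : Commute (creXOut η) (creYOut η) := by
  refine LinearMap.ext fun v => ?_
  have h : creX (creY v) = creY (creX v) := LinearMap.congr_fun creX_mul_creY v
  simp only [creXOut, creYOut, Module.End.mul_apply, LinearMap.add_apply, LinearMap.sub_apply,
    LinearMap.smul_apply, map_add, map_sub, map_smul, h]
  module

theorem sqrt_succ_mul_inv_sqrt_factorial (m n : ℕ) :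
    √((m : ℝ) + 1) * (1 / √(((m + 1)! : ℝ) * (n ! : ℝ))) = 1 / √((m ! : ℝ) * (n ! : ℝ)) := by
  have h : (((m + 1)! : ℕ) : ℝ) * (n ! : ℝ) = ((m : ℝ) + 1) * ((m ! : ℝ) * (n ! : ℝ)) := by
    rw [Nat.factorial_succ]; push_cast; ring
  rw [h, Real.sqrt_mul (by positivity)]
  have h1 : √((m : ℝ) + 1) ≠ 0 := by positivity
  have h2 : √((m ! : ℝ) * (n ! : ℝ)) ≠ 0 := by positivity
  field_simp

theorem beamsplitter_mul_creX (η : ℝ) :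
    beamsplitter η * creX = creXOut η * beamsplitter η := by
  refine end_ext fun ⟨m, n⟩ => ?_
  have h := sqrt_succ_mul_inv_sqrt_factorial m n
  rw [Module.End.mul_apply, Module.End.mul_apply, creX_ket, map_smul, beamsplitter_ket,
    beamsplitter_ket, map_smul, smul_smul, ← Complex.ofReal_mul, h, pow_succ', mul_assoc,
    Module.End.mul_apply]

theorem beamsplitter_mul_creY (η : ℝ) :
    beamsplitter η * creY = creYOut η * beamsplitter η := by
  refine end_ext fun ⟨m, n⟩ => ?_
  have h := sqrt_succ_mul_inv_sqrt_factorial n m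
  rw [Module.End.mul_apply, Module.End.mul_apply, creY_ket, map_smul, beamsplitter_ket,
    beamsplitter_ket, map_smul, smul_smul, ← Complex.ofReal_mul, mul_comm ((m ! : ℕ) : ℝ),
    mul_comm ((m ! : ℕ) : ℝ), h, pow_succ', ← mul_assoc,
    (((creXOut_commute_creYOut η).pow_left m).eq : _ = _), mul_assoc, Module.End.mul_apply]

theorem annX_mul_creXOut (η : ℝ) :
    annX * creXOut η = creXOut η * annX + ((√η : ℝ) : ℂ) • 1 := by
  refine LinearMap.ext fun v => ?_
  have hX : annX (creX v) = _ := LinearMap.congr_fun annX_mul_creX v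
  have hY : annX (creY v) = _ := LinearMap.congr_fun annX_mul_creY v
  simp only [Module.End.mul_apply, LinearMap.add_apply, Module.End.one_apply] at hX hY
  simp only [creXOut, Module.End.mul_apply, LinearMap.add_apply, LinearMap.sub_apply,
    LinearMap.smul_apply, Module.End.one_apply, map_sub, map_smul, hX, hY]
  module

theorem annX_mul_creYOut (η : ℝ) :
    annX * creYOut η = creYOut η * annX + ((√(1 - η) : ℝ) : ℂ) • 1 := by
  refine LinearMap.ext fun v => ?_
  have hX : annX (creX v) = _ := LinearMap.congr_fun annX_mul_creX v
  have hY : annX (creY v) = _ := LinearMap.congr_fun annX_mul_creY v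
  simp only [Module.End.mul_apply, LinearMap.add_apply, Module.End.one_apply] at hX hY
  simp only [creYOut, Module.End.mul_apply, LinearMap.add_apply,
    LinearMap.smul_apply, Module.End.one_apply, map_add, map_smul, hX, hY]
  module

theorem annY_mul_creXOut (η : ℝ) :
    annY * creXOut η = creXOut η * annY - ((√(1 - η) : ℝ) : ℂ) • 1 := by
  refine LinearMap.ext fun v => ?_
  have hX : annY (creX v) = _ := LinearMap.congr_fun annY_mul_creX v
  have hY : annY (creY v) = _ := LinearMap.congr_fun annY_mul_creY v
  simp only [Module.End.mul_apply, LinearMap.add_apply, Module.End.one_apply] at hX hY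
  simp only [creXOut, Module.End.mul_apply, LinearMap.sub_apply,
    LinearMap.smul_apply, Module.End.one_apply, map_sub, map_smul, hX, hY]
  module

theorem annY_mul_creYOut (η : ℝ) :
    annY * creYOut η = creYOut η * annY + ((√η : ℝ) : ℂ) • 1 := by
  refine LinearMap.ext fun v => ?_
  have hX : annY (creX v) = _ := LinearMap.congr_fun annY_mul_creX v
  have hY : annY (creY v) = _ := LinearMap.congr_fun annY_mul_creY v
  simp only [Module.End.mul_apply, LinearMap.add_apply, Module.End.one_apply] at hX hY
  simp only [creYOut, Module.End.mul_apply, LinearMap.add_apply,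
    LinearMap.smul_apply, Module.End.one_apply, map_add, map_smul, hX, hY]
  module

/-- An annihilation-type operator `A` that acts on the output as `B` does on the input. -/
theorem intertwine_of_commutators {η : ℝ} {A B : Module.End ℂ TwoMode} {s t : ℂ}
    (hA : A (ket (0, 0)) = 0) (hB : B (ket (0, 0)) = 0)
    (hAX : A * creXOut η = creXOut η * A + s • 1) (hAY : A * creYOut η = creYOut η * A + t • 1)
    (hBX : B * creX = creX * B + s • 1) (hBY : B * creY = creY * B + t • 1) :
    A * beamsplitter η = beamsplitter η * B := by
  set U := beamsplitter η with hU
  have hX : U * creX = creXOut η * U := beamsplitter_mul_creX η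
  have hY : U * creY = creYOut η * U := beamsplitter_mul_creY η
  -- Both sides kill the vacuum, and both obey the same recursion under creation because `A` and `B`
  -- have the same commutators `s`, `t`.
  have key : ∀ v, v ∈ LinearMap.eqLocus (A * U) (U * B) := by
    refine mem_of_creation_closed ?_ ?_ ?_
    · simp [LinearMap.mem_eqLocus, hA, hB, hU, beamsplitter_vacuum]
    · intro v hv
      rw [LinearMap.mem_eqLocus] at hv ⊢
      have h1 : A * U * creX = creXOut η * (A * U) + s • U := by
        rw [mul_assoc, hX, ← mul_assoc, hAX, add_mul, smul_mul_assoc, one_mul, mul_assoc]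
      have h2 : U * B * creX = creXOut η * (U * B) + s • U := by
        rw [mul_assoc, hBX, mul_add, ← mul_assoc, hX, mul_smul_comm, mul_one, mul_assoc]
      rw [← Module.End.mul_apply, ← Module.End.mul_apply, h1, h2, LinearMap.add_apply,
        LinearMap.add_apply, Module.End.mul_apply, hv]
      rfl
    · intro v hv
      rw [LinearMap.mem_eqLocus] at hv ⊢
      have h1 : A * U * creY = creYOut η * (A * U) + t • U := by
        rw [mul_assoc, hY, ← mul_assoc, hAY, add_mul, smul_mul_assoc, one_mul, mul_assoc]
      have h2 : U * B * creY = creYOut η * (U * B) + t • U := by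
        rw [mul_assoc, hBY, mul_add, ← mul_assoc, hY, mul_smul_comm, mul_one, mul_assoc]
      rw [← Module.End.mul_apply, ← Module.End.mul_apply, h1, h2, LinearMap.add_apply,
        LinearMap.add_apply, Module.End.mul_apply, hv]
      rfl
  exact LinearMap.ext key

theorem annX_vacuum : annX (ket (0, 0)) = 0 := by simp [annX_ket]

theorem annY_vacuum : annY (ket (0, 0)) = 0 := by simp [annY_ket]

/-- The first output mode is `√η x + √(1 - η) y`. -/
theorem annX_mul_beamsplitter (η : ℝ) :
    annX * beamsplitter η =
      beamsplitter η * (((√η : ℝ) : ℂ) • annX + ((√(1 - η) : ℝ) : ℂ) • annY) := by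
  refine intertwine_of_commutators annX_vacuum (by simp [annX_vacuum, annY_vacuum])
    (annX_mul_creXOut η) (annX_mul_creYOut η) ?_ ?_
  · refine LinearMap.ext fun v => ?_
    have hX : annX (creX v) = _ := LinearMap.congr_fun annX_mul_creX v
    have hY : annY (creX v) = _ := LinearMap.congr_fun annY_mul_creX v
    simp only [Module.End.mul_apply, LinearMap.add_apply, Module.End.one_apply] at hX hY
    simp only [Module.End.mul_apply, LinearMap.add_apply,
      LinearMap.smul_apply, Module.End.one_apply, map_add, map_smul, hX, hY]
    module
  · refine LinearMap.ext fun v => ?_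
    have hX : annX (creY v) = _ := LinearMap.congr_fun annX_mul_creY v
    have hY : annY (creY v) = _ := LinearMap.congr_fun annY_mul_creY v
    simp only [Module.End.mul_apply, LinearMap.add_apply, Module.End.one_apply] at hX hY
    simp only [Module.End.mul_apply, LinearMap.add_apply,
      LinearMap.smul_apply, Module.End.one_apply, map_add, map_smul, hX, hY]
    module

/-- The second output mode is `√η y - √(1 - η) x`. -/
theorem annY_mul_beamsplitter (η : ℝ) :
    annY * beamsplitter η =
      beamsplitter η * (((√η : ℝ) : ℂ) • annY - ((√(1 - η) : ℝ) : ℂ) • annX) := by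
  -- The sign of `s` comes from the minus sign in front of `creY` in `creXOut`.
  refine intertwine_of_commutators (s := -((√(1 - η) : ℝ) : ℂ)) annY_vacuum
    (by simp [annX_vacuum, annY_vacuum]) ?_ (annY_mul_creYOut η) ?_ ?_
  · rw [annY_mul_creXOut]
    module
  · refine LinearMap.ext fun v => ?_
    have hX : annX (creX v) = _ := LinearMap.congr_fun annX_mul_creX v
    have hY : annY (creX v) = _ := LinearMap.congr_fun annY_mul_creX v
    simp only [Module.End.mul_apply, LinearMap.add_apply, Module.End.one_apply] at hX hY
    simp only [Module.End.mul_apply, LinearMap.add_apply, LinearMap.sub_apply,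
      LinearMap.smul_apply, Module.End.one_apply, map_sub, map_smul, hX, hY]
    module
  · refine LinearMap.ext fun v => ?_
    have hX : annX (creY v) = _ := LinearMap.congr_fun annX_mul_creY v
    have hY : annY (creY v) = _ := LinearMap.congr_fun annY_mul_creY v
    simp only [Module.End.mul_apply, LinearMap.add_apply, Module.End.one_apply] at hX hY
    simp only [Module.End.mul_apply, LinearMap.add_apply, LinearMap.sub_apply,
      LinearMap.smul_apply, Module.End.one_apply, map_sub, map_smul, hX, hY]
    module

/-! ### The beamsplitter preserves the pairing of vectors -/

/-- The bilinear pairing `∑ v_a w_a` of finite-photon vectors, as a functional of `w`. -/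
noncomputable def pairing (v : TwoMode) : TwoMode →ₗ[ℂ] ℂ := Finsupp.linearCombination ℂ v

theorem pairing_ket (v : TwoMode) (a : ℕ × ℕ) : pairing v (ket a) = v a := by
  simp [pairing, ket]

theorem pairing_eq_sum (v w : TwoMode) (s : Finset (ℕ × ℕ)) (hs : w.support ⊆ s) :
    pairing v w = ∑ a ∈ s, v a * w a := by
  rw [pairing, Finsupp.linearCombination_apply, Finsupp.sum_of_support_subset _ hs _ (by simp)]
  simp [mul_comm]

theorem pairing_comm (v w : TwoMode) : pairing v w = pairing w v := by
  rw [pairing_eq_sum v w (v.support ∪ w.support) Finset.subset_union_right,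
    pairing_eq_sum w v (v.support ∪ w.support) Finset.subset_union_left]
  simp [mul_comm]

theorem pairing_add_left (u v w : TwoMode) : pairing (u + v) w = pairing u w + pairing v w := by
  rw [pairing_comm, map_add, pairing_comm w, pairing_comm w]

theorem pairing_sub_left (u v w : TwoMode) : pairing (u - v) w = pairing u w - pairing v w := by
  rw [pairing_comm, map_sub, pairing_comm w, pairing_comm w]

theorem pairing_smul_left (c : ℂ) (v w : TwoMode) : pairing (c • v) w = c * pairing v w := by
  rw [pairing_comm, map_smul, pairing_comm w, smul_eq_mul]

/-- Ladder operators have real matrix entries, so creation and annihilation are adjoint already for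
the bilinear pairing and no conjugation is needed. -/
theorem pairing_creX (v w : TwoMode) : pairing v (creX w) = pairing (annX v) w := by
  rw [pairing_comm, pairing_comm (annX v)]
  have : (pairing (creX w)) = (pairing w) ∘ₗ annX := by
    refine Finsupp.lhom_ext' fun a => LinearMap.ext_ring ?_
    change pairing (creX w) (ket a) = pairing w (annX (ket a))
    rw [pairing_ket, annX_ket, map_smul, pairing_ket, creX_apply, smul_eq_mul]
  rw [this, LinearMap.comp_apply]

theorem pairing_creY (v w : TwoMode) : pairing v (creY w) = pairing (annY v) w := by
  rw [pairing_comm, pairing_comm (annY v)]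
  have : (pairing (creY w)) = (pairing w) ∘ₗ annY := by
    refine Finsupp.lhom_ext' fun a => LinearMap.ext_ring ?_
    change pairing (creY w) (ket a) = pairing w (annY (ket a))
    rw [pairing_ket, annY_ket, map_smul, pairing_ket, creY_apply, smul_eq_mul]
  rw [this, LinearMap.comp_apply]

/-- A vector in the range of a creation operator has no vacuum component, before or after the
beamsplitter; this is the base case of `pairing_beamsplitter`. -/
theorem beamsplitter_apply_vacuum (η : ℝ) (v : TwoMode) : beamsplitter η v (0, 0) = v (0, 0) := by
  have key : ∀ v, v ∈ LinearMap.eqLocus (Finsupp.lapply (0, 0) ∘ₗ beamsplitter η)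
      (Finsupp.lapply (R := ℂ) (M := ℂ) ((0, 0) : ℕ × ℕ)) := by
    refine mem_of_creation_closed ?_ ?_ ?_
    · simp [LinearMap.mem_eqLocus, beamsplitter_vacuum]
    · intro v _
      rw [LinearMap.mem_eqLocus, LinearMap.comp_apply, ← Module.End.mul_apply,
        beamsplitter_mul_creX]
      simp [creXOut, creX_apply, creY_apply]
    · intro v _
      rw [LinearMap.mem_eqLocus, LinearMap.comp_apply, ← Module.End.mul_apply,
        beamsplitter_mul_creY]
      simp [creYOut, creX_apply, creY_apply]
  exact key v

theorem sqrt_sq_add_sqrt_one_sub_sq {η : ℝ} (h0 : 0 ≤ η) (h1 : η ≤ 1) :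
    ((√η : ℝ) : ℂ) * ((√η : ℝ) : ℂ) + ((√(1 - η) : ℝ) : ℂ) * ((√(1 - η) : ℝ) : ℂ) = 1 := by
  rw [ofReal_sqrt_mul_self h0, ofReal_sqrt_mul_self (by linarith)]
  push_cast
  ring

/-- Inverts the rotation relating output and input annihilation operators; `η + (1 - η) = 1` is its
determinant. -/
theorem beamsplitter_annX {η : ℝ} (h0 : 0 ≤ η) (h1 : η ≤ 1) (v : TwoMode) :
    ((√η : ℝ) : ℂ) • annX (beamsplitter η v) - ((√(1 - η) : ℝ) : ℂ) • annY (beamsplitter η v) =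
      beamsplitter η (annX v) := by
  rw [← Module.End.mul_apply, ← Module.End.mul_apply, annX_mul_beamsplitter,
    annY_mul_beamsplitter, Module.End.mul_apply, Module.End.mul_apply]
  have h := sqrt_sq_add_sqrt_one_sub_sq h0 h1
  simp only [LinearMap.add_apply, LinearMap.sub_apply, LinearMap.smul_apply, map_add, map_sub,
    map_smul]
  match_scalars
  · linear_combination h
  · ring

theorem beamsplitter_annY {η : ℝ} (h0 : 0 ≤ η) (h1 : η ≤ 1) (v : TwoMode) :
    ((√(1 - η) : ℝ) : ℂ) • annX (beamsplitter η v) + ((√η : ℝ) : ℂ) • annY (beamsplitter η v) =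
      beamsplitter η (annY v) := by
  rw [← Module.End.mul_apply, ← Module.End.mul_apply, annX_mul_beamsplitter,
    annY_mul_beamsplitter, Module.End.mul_apply, Module.End.mul_apply]
  have h := sqrt_sq_add_sqrt_one_sub_sq h0 h1
  simp only [LinearMap.add_apply, LinearMap.sub_apply, LinearMap.smul_apply, map_add, map_sub,
    map_smul]
  match_scalars
  · ring
  · linear_combination h

theorem pairing_beamsplitter {η : ℝ} (h0 : 0 ≤ η) (h1 : η ≤ 1) (v w : TwoMode) :
    pairing (beamsplitter η v) (beamsplitter η w) = pairing v w := by
  -- Induction on `w` only, with `v` universally quantified: a creation operator on `w` moves across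
  -- the pairing and becomes an annihilation operator on `v`.
  let p : Submodule ℂ TwoMode :=
    { carrier := {w | ∀ v, pairing (beamsplitter η v) (beamsplitter η w) = pairing v w}
      add_mem' := fun {a b} ha hb v => by simp only [map_add, ha v, hb v]
      zero_mem' := fun v => by simp
      smul_mem' := fun c a ha v => by simp only [map_smul, ha v] }
  have key : ∀ w, w ∈ p := by
    refine mem_of_creation_closed ?_ ?_ ?_
    · intro v
      rw [beamsplitter_vacuum, pairing_ket, pairing_ket, beamsplitter_apply_vacuum]
    · intro w hw v
      have e : beamsplitter η (creX w) = creXOut η (beamsplitter η w) := by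
        rw [← Module.End.mul_apply, beamsplitter_mul_creX, Module.End.mul_apply]
      rw [e, pairing_creX, ← hw, ← beamsplitter_annX h0 h1, pairing_sub_left, pairing_smul_left,
        pairing_smul_left, ← pairing_creX, ← pairing_creY]
      simp [creXOut]
    · intro w hw v
      have e : beamsplitter η (creY w) = creYOut η (beamsplitter η w) := by
        rw [← Module.End.mul_apply, beamsplitter_mul_creY, Module.End.mul_apply]
      rw [e, pairing_creY, ← hw, ← beamsplitter_annY h0 h1, pairing_add_left, pairing_smul_left,
        pairing_smul_left, ← pairing_creX, ← pairing_creY]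
      simp [creYOut]
  exact key w v

/-! ### The beamsplitter on Bargmann polynomials -/

/-- Evaluation at `(z, w)` of the Bargmann polynomial of a finite-photon vector. -/
noncomputable def bargmann (z w : ℂ) : TwoMode →ₗ[ℂ] ℂ :=
  Finsupp.linearCombination ℂ fun a : ℕ × ℕ =>
    (((1 / √((a.1 ! : ℝ) * (a.2 ! : ℝ)) : ℝ)) : ℂ) * (z ^ a.1 * w ^ a.2)

theorem bargmann_ket (z w : ℂ) (a : ℕ × ℕ) : bargmann z w (ket a) =
    (((1 / √((a.1 ! : ℝ) * (a.2 ! : ℝ)) : ℝ)) : ℂ) * (z ^ a.1 * w ^ a.2) := by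
  simp [bargmann, ket]

theorem bargmann_creX (z w : ℂ) (v : TwoMode) :
    bargmann z w (creX v) = z * bargmann z w v := by
  have : bargmann z w ∘ₗ creX = z • bargmann z w := by
    refine Finsupp.lhom_ext' fun a => LinearMap.ext_ring ?_
    change bargmann z w (creX (ket a)) = z * bargmann z w (ket a)
    obtain ⟨m, n⟩ := a
    rw [creX_ket, map_smul, bargmann_ket, bargmann_ket, smul_eq_mul, ← mul_assoc,
      ← Complex.ofReal_mul, sqrt_succ_mul_inv_sqrt_factorial]
    ring
  exact LinearMap.congr_fun this v

theorem bargmann_creY (z w : ℂ) (v : TwoMode) :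
    bargmann z w (creY v) = w * bargmann z w v := by
  have : bargmann z w ∘ₗ creY = w • bargmann z w := by
    refine Finsupp.lhom_ext' fun a => LinearMap.ext_ring ?_
    change bargmann z w (creY (ket a)) = w * bargmann z w (ket a)
    obtain ⟨m, n⟩ := a
    rw [creY_ket, map_smul, bargmann_ket, bargmann_ket, smul_eq_mul, ← mul_assoc,
      ← Complex.ofReal_mul, mul_comm ((m ! : ℕ) : ℝ), mul_comm ((m ! : ℕ) : ℝ),
      sqrt_succ_mul_inv_sqrt_factorial]
    ring
  exact LinearMap.congr_fun this v

/-- Creation operators multiply by the variables, so rotating them amounts to a linear substitution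
in the polynomial. -/
theorem bargmann_beamsplitter (η : ℝ) (z w : ℂ) (v : TwoMode) :
    bargmann z w (beamsplitter η v) =
      bargmann (((√η : ℝ) : ℂ) * z - ((√(1 - η) : ℝ) : ℂ) * w)
        (((√(1 - η) : ℝ) : ℂ) * z + ((√η : ℝ) : ℂ) * w) v := by
  set z' := ((√η : ℝ) : ℂ) * z - ((√(1 - η) : ℝ) : ℂ) * w
  set w' := ((√(1 - η) : ℝ) : ℂ) * z + ((√η : ℝ) : ℂ) * w
  have key : ∀ v, v ∈ LinearMap.eqLocus (bargmann z w ∘ₗ beamsplitter η) (bargmann z' w') := by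
    refine mem_of_creation_closed ?_ ?_ ?_
    · simp [LinearMap.mem_eqLocus, beamsplitter_vacuum, bargmann_ket]
    · intro v hv
      rw [LinearMap.mem_eqLocus, LinearMap.comp_apply] at hv ⊢
      rw [← Module.End.mul_apply, beamsplitter_mul_creX, bargmann_creX, ← hv]
      simp only [Module.End.mul_apply, creXOut, LinearMap.sub_apply, LinearMap.smul_apply, map_sub,
        map_smul, bargmann_creX, bargmann_creY, smul_eq_mul]
      ring
    · intro v hv
      rw [LinearMap.mem_eqLocus, LinearMap.comp_apply] at hv ⊢
      rw [← Module.End.mul_apply, beamsplitter_mul_creY, bargmann_creY, ← hv]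
      simp only [Module.End.mul_apply, creYOut, LinearMap.add_apply, LinearMap.smul_apply, map_add,
        map_smul, bargmann_creX, bargmann_creY, smul_eq_mul]
      ring
  exact key v

/-! ### Matrix elements of the beamsplitter -/

theorem bsMatrix_succ_fst (η : ℝ) (a : ℕ × ℕ) (m n : ℕ) :
    bsMatrix η a (m + 1, n) = (((√((m : ℝ) + 1) : ℝ) : ℂ))⁻¹ *
      (((√η : ℝ) : ℂ) * (((√(a.1 : ℝ) : ℝ) : ℂ) * bsMatrix η (a.1 - 1, a.2) (m, n)) -
        ((√(1 - η) : ℝ) : ℂ) * (((√(a.2 : ℝ) : ℝ) : ℂ) * bsMatrix η (a.1, a.2 - 1) (m, n))) := by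
  rw [bsMatrix, ket_succ_fst, map_smul, ← Module.End.mul_apply, beamsplitter_mul_creX]
  simp only [creXOut, creX_apply, creY_apply, bsMatrix, Module.End.mul_apply, LinearMap.sub_apply,
    LinearMap.smul_apply, Finsupp.coe_smul, Finsupp.coe_sub, Pi.smul_apply, Pi.sub_apply,
    smul_eq_mul]

theorem bsMatrix_succ_snd (η : ℝ) (a : ℕ × ℕ) (m n : ℕ) :
    bsMatrix η a (m, n + 1) = (((√((n : ℝ) + 1) : ℝ) : ℂ))⁻¹ *
      (((√(1 - η) : ℝ) : ℂ) * (((√(a.1 : ℝ) : ℝ) : ℂ) * bsMatrix η (a.1 - 1, a.2) (m, n)) +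
        ((√η : ℝ) : ℂ) * (((√(a.2 : ℝ) : ℝ) : ℂ) * bsMatrix η (a.1, a.2 - 1) (m, n))) := by
  rw [bsMatrix, ket_succ_snd, map_smul, ← Module.End.mul_apply, beamsplitter_mul_creY]
  simp only [creYOut, creX_apply, creY_apply, bsMatrix, Module.End.mul_apply, LinearMap.add_apply,
    LinearMap.smul_apply, Finsupp.coe_smul, Finsupp.coe_add, Pi.smul_apply, Pi.add_apply,
    smul_eq_mul]

/-- The column recursion has real coefficients. Consequently the conjugate transpose is the
transpose, and the bilinear pairing suffices for unitarity. -/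
theorem conj_bsMatrix (η : ℝ) (a b : ℕ × ℕ) : conj (bsMatrix η a b) = bsMatrix η a b := by
  refine number_induction (P := fun b => ∀ a, conj (bsMatrix η a b) = bsMatrix η a b) ?_ ?_ ?_ b a
  · intro a
    rw [bsMatrix, beamsplitter_vacuum, ket, Finsupp.single_apply]
    split_ifs <;> simp
  · intro m n h a
    rw [bsMatrix_succ_fst]
    simp only [map_mul, map_sub, map_inv₀, Complex.conj_ofReal, h]
  · intro m n h a
    rw [bsMatrix_succ_snd]
    simp only [map_mul, map_add, map_inv₀, Complex.conj_ofReal, h]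

/-- The beamsplitter preserves the number of photons. -/
theorem bsMatrix_eq_zero (η : ℝ) {a b : ℕ × ℕ} (hab : a.1 + a.2 ≠ b.1 + b.2) :
    bsMatrix η a b = 0 := by
  refine number_induction
    (P := fun b => ∀ a : ℕ × ℕ, a.1 + a.2 ≠ b.1 + b.2 → bsMatrix η a b = 0) ?_ ?_ ?_ b a hab
  · intro a h
    rw [bsMatrix, beamsplitter_vacuum, ket, Finsupp.single_apply, if_neg]
    rintro rfl
    exact h rfl
  · rintro m n ih ⟨k, l⟩ h
    have h1 : ((√(k : ℝ) : ℝ) : ℂ) * bsMatrix η (k - 1, l) (m, n) = 0 := by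
      rcases k with _ | k
      · simp
      · rw [add_tsub_cancel_right, ih (k, l) (by dsimp only at h ⊢; omega), mul_zero]
    have h2 : ((√(l : ℝ) : ℝ) : ℂ) * bsMatrix η (k, l - 1) (m, n) = 0 := by
      rcases l with _ | l
      · simp
      · rw [add_tsub_cancel_right, ih (k, l) (by dsimp only at h ⊢; omega), mul_zero]
    rw [bsMatrix_succ_fst, h1, h2]
    simp
  · rintro m n ih ⟨k, l⟩ h
    have h1 : ((√(k : ℝ) : ℝ) : ℂ) * bsMatrix η (k - 1, l) (m, n) = 0 := by
      rcases k with _ | k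
      · simp
      · rw [add_tsub_cancel_right, ih (k, l) (by dsimp only at h ⊢; omega), mul_zero]
    have h2 : ((√(l : ℝ) : ℝ) : ℂ) * bsMatrix η (k, l - 1) (m, n) = 0 := by
      rcases l with _ | l
      · simp
      · rw [add_tsub_cancel_right, ih (k, l) (by dsimp only at h ⊢; omega), mul_zero]
    rw [bsMatrix_succ_snd, h1, h2]
    simp

end NumberMixing

/-! ### Infinite density matrices and photon-number blocks of the output state. -/

namespace NumberMixing

open Finset.HasAntidiagonal (antidiagonal mem_antidiagonal)

/-! ### Positive semidefinite infinite matrices with summable diagonal -/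

/-- The terms of the double series for `⟨c| ρ |c⟩`. -/
def quadTerm {ι : Type*} (ρ : Matrix ι ι ℂ) (c : ι → ℂ) (a : ι × ι) : ℂ :=
  conj (c a.1) * ρ a.1 a.2 * c a.2

theorem posSemidef_iff_sum_nonneg {ι : Type*} {ρ : Matrix ι ι ℂ} :
    ρ.PosSemidef ↔ ρ.IsHermitian ∧
      ∀ (s : Finset ι) (c : ι → ℂ), 0 ≤ ∑ i ∈ s, ∑ j ∈ s, conj (c i) * ρ i j * c j := by
  classical
  refine and_congr_right fun _ => ⟨fun h s c => ?_, fun h x => h x.support x⟩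
  let x : ι →₀ ℂ := Finsupp.onFinset s (fun i => if i ∈ s then c i else 0) (by
    intro i hi; by_contra h'; simp [h'] at hi)
  have hx : x.support ⊆ s := Finsupp.support_onFinset_subset
  have h1 := h x
  rw [Finsupp.sum_of_support_subset _ hx _ (by simp)] at h1
  convert h1 using 1
  refine Finset.sum_congr rfl fun i hi => ?_
  rw [Finsupp.sum_of_support_subset _ hx _ (by simp)]
  refine Finset.sum_congr rfl fun j hj => ?_
  simp [x, hi, hj]

/-- Gives access to results on finite matrices; blocks on two indices already force Hermitian
symmetry. -/
theorem posSemidef_of_finset {ι : Type*} {ρ : Matrix ι ι ℂ}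
    (h : ∀ s : Finset ι, (ρ.submatrix ((↑) : s → ι) (↑)).PosSemidef) : ρ.PosSemidef := by
  classical
  rw [posSemidef_iff_sum_nonneg]
  refine ⟨Matrix.ext fun i j => ?_, fun s c => ?_⟩
  · exact (h {i, j}).1.apply ⟨i, by simp⟩ ⟨j, by simp⟩
  · have := (posSemidef_iff_sum_nonneg.1 (h s)).2 Finset.univ fun i => c i
    rw [← Finset.sum_coe_sort s]
    simp_rw [← Finset.sum_coe_sort s]
    exact this

/-- The principal minor on the indices `i`, `j` has nonnegative determinant. -/
theorem norm_le_of_posSemidef {ι : Type*} {ρ : Matrix ι ι ℂ} (h : ρ.PosSemidef) (i j : ι) :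
    ‖ρ i j‖ ≤ √(ρ i i).re * √(ρ j j).re := by
  have h1 := (h.submatrix ![i, j]).det_nonneg
  have hi := Complex.nonneg_iff.1 (h.diag_nonneg (i := i))
  have hj := Complex.nonneg_iff.1 (h.diag_nonneg (i := j))
  have hij : ρ j i = conj (ρ i j) := (h.1.apply j i).symm
  rw [Matrix.det_fin_two] at h1
  simp only [Matrix.submatrix_apply, Matrix.cons_val_zero, Matrix.cons_val_one, hij,
    Complex.mul_conj] at h1
  have h2 := (Complex.nonneg_iff.1 h1).1
  simp only [Complex.sub_re, Complex.mul_re, ← hi.2, zero_mul, sub_zero, Complex.ofReal_re,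
    Complex.normSq_eq_norm_sq] at h2
  rw [← Real.sqrt_mul hi.1]
  exact Real.le_sqrt_of_sq_le (by linarith)

theorem summable_re {ι : Type*} {f : ι → ℂ} (h : Summable f) : Summable fun i => (f i).re :=
  (Complex.hasSum_re h.hasSum).summable

/-- The mean inequality is applied crosswise, pairing the weight of one index with the diagonal
entry of the other, so that the bound is summable over pairs. -/
theorem norm_quadTerm_le {ι : Type*} {ρ : Matrix ι ι ℂ} (h : ρ.PosSemidef) (c : ι → ℂ)
    (a : ι × ι) : ‖quadTerm ρ c a‖ ≤
      (‖c a.1‖ ^ 2 * (ρ a.2 a.2).re + (ρ a.1 a.1).re * ‖c a.2‖ ^ 2) / 2 := by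
  have hi := (Complex.nonneg_iff.1 (h.diag_nonneg (i := a.1))).1
  have hj := (Complex.nonneg_iff.1 (h.diag_nonneg (i := a.2))).1
  have h1 := norm_le_of_posSemidef h a.1 a.2
  have e1 := Real.sq_sqrt hi
  have e2 := Real.sq_sqrt hj
  rw [quadTerm, norm_mul, norm_mul, RCLike.norm_conj]
  calc ‖c a.1‖ * ‖ρ a.1 a.2‖ * ‖c a.2‖
      ≤ ‖c a.1‖ * (√(ρ a.1 a.1).re * √(ρ a.2 a.2).re) * ‖c a.2‖ := by gcongr
    _ ≤ _ := by
      have := sq_nonneg (‖c a.1‖ * √(ρ a.2 a.2).re - √(ρ a.1 a.1).re * ‖c a.2‖)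
      rw [← e1, ← e2, Real.sqrt_sq (Real.sqrt_nonneg _), Real.sqrt_sq (Real.sqrt_nonneg _)]
      nlinarith

theorem summable_norm_quadTerm {ι : Type*} {ρ : Matrix ι ι ℂ} (h : ρ.PosSemidef)
    (hs : Summable fun i => ρ i i) {c : ι → ℂ} (hc : Summable fun i => ‖c i‖ ^ 2) :
    Summable fun a => ‖quadTerm ρ c a‖ := by
  have hr := summable_re hs
  have hn : ∀ i, 0 ≤ (ρ i i).re := fun i => (Complex.nonneg_iff.1 (h.diag_nonneg (i := i))).1
  refine Summable.of_nonneg_of_le (fun _ => norm_nonneg _) (norm_quadTerm_le h c) ?_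
  exact ((hc.mul_of_nonneg hr (fun _ => by positivity) hn).add
    (hr.mul_of_nonneg hc hn (fun _ => by positivity))).div_const 2

/-- Squares `s ×ˢ s` are cofinal among finite sets of pairs, so the sum is a limit of finite
quadratic forms. -/
theorem tsum_quadTerm_nonneg {ι : Type*} {ρ : Matrix ι ι ℂ} (h : ρ.PosSemidef)
    {c : ι → ℂ} (hs : Summable (quadTerm ρ c)) : 0 ≤ ∑' a, quadTerm ρ c a := by
  have h1 : Filter.Tendsto (fun s : Finset ι => ∑ a ∈ s ×ˢ s, quadTerm ρ c a) Filter.atTop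
      (nhds (∑' a, quadTerm ρ c a)) := by
    have := hs.hasSum
    exact this.comp (Filter.tendsto_finsetProd_atTop.comp
      (Filter.tendsto_atTop_diagonal))
  refine ge_of_tendsto' h1 fun s => ?_
  rw [Finset.sum_product]
  exact (posSemidef_iff_sum_nonneg.1 h).2 s c

theorem IsDensity.summable_norm_quadTerm {ι : Type*} {ρ : Matrix ι ι ℂ} (h : IsDensity ρ)
    {c : ι → ℂ} (hc : Summable fun i => ‖c i‖ ^ 2) : Summable fun a => ‖quadTerm ρ c a‖ :=
  NumberMixing.summable_norm_quadTerm h.1 h.2.summable hc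

theorem IsDensity.hasSum_re {ι : Type*} {ρ : Matrix ι ι ℂ} (h : IsDensity ρ) :
    HasSum (fun i => (ρ i i).re) 1 := Complex.hasSum_re h.2

theorem IsDensity.diag_re_nonneg {ι : Type*} {ρ : Matrix ι ι ℂ} (h : IsDensity ρ) (i : ι) :
    0 ≤ (ρ i i).re := (Complex.nonneg_iff.1 (h.1.diag_nonneg (i := i))).1

theorem IsDensity.diag_eq_re {ι : Type*} {ρ : Matrix ι ι ℂ} (h : IsDensity ρ) (i : ι) :
    ρ i i = ((ρ i i).re : ℂ) :=
  Complex.ext (by simp) (by simpa using (Complex.nonneg_iff.1 (h.1.diag_nonneg (i := i))).2.symm)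

/-! ### Product states and the partial trace -/

/-- A finite set of pairs lies in the product of its two projections, where the finite-dimensional
result applies. -/
theorem kronecker_posSemidef {ι κ : Type*} {ρ : Matrix ι ι ℂ} {σ : Matrix κ κ ℂ}
    (hρ : ρ.PosSemidef) (hσ : σ.PosSemidef) : (ρ ⊗ₖ σ).PosSemidef := by
  classical
  refine posSemidef_of_finset fun s => ?_
  let f : s → (s.image Prod.fst) × (s.image Prod.snd) := fun a =>
    (⟨a.1.1, Finset.mem_image_of_mem _ a.2⟩, ⟨a.1.2, Finset.mem_image_of_mem _ a.2⟩)
  exact ((hρ.submatrix ((↑) : s.image Prod.fst → ι)).kronecker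
    (hσ.submatrix ((↑) : s.image Prod.snd → κ))).submatrix f

theorem hasSum_mul_one {ι κ : Type*} {f : ι → ℂ} {g : κ → ℂ} (hf : HasSum f 1)
    (hg : HasSum g 1) : HasSum (fun a : ι × κ => f a.1 * g a.2) 1 := by
  have hs : Summable fun a : ι × κ => f a.1 * g a.2 :=
    summable_mul_of_summable_norm hf.summable.norm hg.summable.norm
  have h := hf.mul hg hs
  rwa [one_mul] at h

theorem IsDensity.kronecker {ι κ : Type*} {ρ : Matrix ι ι ℂ} {σ : Matrix κ κ ℂ}
    (hρ : IsDensity ρ) (hσ : IsDensity σ) : IsDensity (ρ ⊗ₖ σ) := by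
  refine ⟨kronecker_posSemidef hρ.1 hσ.1, ?_⟩
  exact hasSum_mul_one (f := fun i => ρ i i) (g := fun i => σ i i) hρ.2 hσ.2

theorem IsDensity.summable_partialTrace {T : Matrix (ℕ × ℕ) (ℕ × ℕ) ℂ} (hT : IsDensity T)
    (j j' : ℕ) : Summable fun k => ‖T (j, k) (j', k)‖ := by
  have hr := hT.hasSum_re.summable
  have h1 : ∀ j : ℕ, Summable fun k => (T (j, k) (j, k)).re := fun j =>
    hr.comp_injective (i := fun k => (j, k)) (fun a b h => (Prod.mk.inj h).2)
  refine Summable.of_nonneg_of_le (fun _ => norm_nonneg _) (fun k => ?_) ((h1 j).add (h1 j'))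
  refine (norm_le_of_posSemidef hT.1 _ _).trans ?_
  have e1 := Real.sq_sqrt (hT.diag_re_nonneg (j, k))
  have e2 := Real.sq_sqrt (hT.diag_re_nonneg (j', k))
  nlinarith [sq_nonneg (√(T (j, k) (j, k)).re - √(T (j', k) (j', k)).re),
    sq_nonneg (√(T (j, k) (j, k)).re), sq_nonneg (√(T (j', k) (j', k)).re)]

theorem IsDensity.partialTrace {T : Matrix (ℕ × ℕ) (ℕ × ℕ) ℂ} (hT : IsDensity T) :
    IsDensity (partialTrace T) := by
  refine ⟨posSemidef_iff_sum_nonneg.2 ⟨Matrix.ext fun j j' => ?_, fun s c => ?_⟩, ?_⟩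
  · rw [Matrix.conjTranspose_apply, NumberMixing.partialTrace, NumberMixing.partialTrace,
      ← starRingEnd_apply, Complex.conj_tsum]
    exact tsum_congr fun k => hT.1.1.apply _ _
  · have h1 : ∑ i ∈ s, ∑ j ∈ s, conj (c i) * NumberMixing.partialTrace T i j * c j =
        ∑' k, ∑ i ∈ s, ∑ j ∈ s, conj (c i) * T (i, k) (j, k) * c j := by
      have hsm : ∀ i j : ℕ, Summable fun k => conj (c i) * T (i, k) (j, k) * c j := fun i j =>
        ((hT.summable_partialTrace i j).of_norm.mul_left _).mul_right _
      rw [Summable.tsum_finsetSum fun i _ => summable_sum fun j _ => hsm i j]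
      refine Finset.sum_congr rfl fun i _ => ?_
      rw [Summable.tsum_finsetSum fun j _ => hsm i j]
      refine Finset.sum_congr rfl fun j _ => ?_
      rw [tsum_mul_right, tsum_mul_left, NumberMixing.partialTrace]
    rw [h1]
    refine tsum_nonneg fun k => ?_
    exact (posSemidef_iff_sum_nonneg.1 (hT.1.submatrix fun j : ℕ => (j, k))).2 s c
  · exact hT.2.prod_fiberwise fun j => (hT.summable_partialTrace j j).of_norm.hasSum

/-! ### Number blocks of the beamsplitter -/

theorem tsum_eq_of_antidiagonal_sum_eq {f g : ℕ × ℕ → ℂ} (hf : Summable f) (hg : Summable g)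
    (h : ∀ N, ∑ a ∈ antidiagonal N, f a = ∑ a ∈ antidiagonal N, g a) :
    ∑' a, f a = ∑' a, g a := by
  have e : ∀ {f : ℕ × ℕ → ℂ}, Summable f →
      ∑' a, f a = ∑' N, ∑ a ∈ antidiagonal N, f a := fun {f} hf => by
    rw [← Finset.HasAntidiagonal.sigmaAntidiagonalEquivProd.tsum_eq f,
      Summable.tsum_sigma (f := fun x => f (Finset.HasAntidiagonal.sigmaAntidiagonalEquivProd x))
      (Finset.HasAntidiagonal.sigmaAntidiagonalEquivProd.summable_iff.2 hf)]
    refine tsum_congr fun N => ?_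
    rw [tsum_fintype]
    exact Finset.sum_coe_sort (antidiagonal N) f
  rw [e hf, e hg]
  exact tsum_congr h

theorem summable_of_antidiagonal_sum_eq {f g : ℕ × ℕ → ℝ} (hf : ∀ a, 0 ≤ f a) (hg : ∀ a, 0 ≤ g a)
    (h : ∀ N, ∑ a ∈ antidiagonal N, f a = ∑ a ∈ antidiagonal N, g a)
    (hs : Summable f) : Summable g := by
  rw [← Finset.HasAntidiagonal.sigmaAntidiagonalEquivProd.summable_iff,
    summable_sigma_of_nonneg fun x => by simp [hf, hg]] at hs ⊢
  refine ⟨fun N => Summable.of_finite, ?_⟩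
  convert hs.2 using 1
  funext N
  rw [tsum_fintype, tsum_fintype]
  have h1 := Finset.sum_coe_sort (antidiagonal N) f
  have h2 := Finset.sum_coe_sort (antidiagonal N) g
  exact h2.trans ((h N).symm.trans h1.symm)

theorem sum_antidiagonal_bsMatrix_mul {η : ℝ} (h0 : 0 ≤ η) (h1 : η ≤ 1) (c d : ℕ × ℕ) :
    ∑ a ∈ antidiagonal (d.1 + d.2), bsMatrix η a c * bsMatrix η a d =
      if c = d then 1 else 0 := by
  have h := pairing_beamsplitter h0 h1 (ket c) (ket d)
  rw [pairing_ket, pairing_eq_sum _ _ (antidiagonal (d.1 + d.2))] at h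
  · rw [ket, Finsupp.single_apply] at h
    exact h
  · intro a ha
    rw [mem_antidiagonal]
    by_contra h'
    exact (Finsupp.mem_support_iff.1 ha) (bsMatrix_eq_zero η h')

/-- Columns are orthonormal by `sum_antidiagonal_bsMatrix_mul`; on a finite block a left inverse is
a right inverse, so rows are too. Different blocks do not interact. -/
theorem sum_antidiagonal_bsMatrix_mul' {η : ℝ} (h0 : 0 ≤ η) (h1 : η ≤ 1) (a b : ℕ × ℕ) :
    ∑ c ∈ antidiagonal (a.1 + a.2), bsMatrix η a c * bsMatrix η b c =
      if a = b then 1 else 0 := by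
  by_cases hab : a.1 + a.2 = b.1 + b.2
  · let B : Matrix (antidiagonal (a.1 + a.2)) (antidiagonal (a.1 + a.2)) ℂ :=
      fun a b => bsMatrix η a b
    have hB : B.transpose * B = 1 := by
      ext c d
      have hd := mem_antidiagonal.1 d.2
      have h := sum_antidiagonal_bsMatrix_mul h0 h1 c.1 d.1
      rw [hd] at h
      rw [Matrix.mul_apply, Matrix.one_apply]
      simp only [Subtype.ext_iff]
      rw [← h]
      exact Finset.sum_coe_sort (antidiagonal (a.1 + a.2))
        (fun x => bsMatrix η x c * bsMatrix η x d)
    have hB1 : B * B.transpose = 1 := _root_.mul_eq_one_comm.1 hB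
    have hB' := congrFun (congrFun hB1 ⟨a, mem_antidiagonal.2 rfl⟩)
      ⟨b, mem_antidiagonal.2 hab.symm⟩
    rw [Matrix.mul_apply, Matrix.one_apply] at hB'
    simp only [Subtype.mk.injEq] at hB'
    rw [← hB']
    exact (Finset.sum_coe_sort (antidiagonal (a.1 + a.2))
        (fun x => bsMatrix η a x * bsMatrix η b x)).symm
  · rw [if_neg (by rintro rfl; exact hab rfl)]
    refine Finset.sum_eq_zero fun c hc => ?_
    rw [mem_antidiagonal] at hc
    rw [bsMatrix_eq_zero η (a := b) (b := c) (by omega), mul_zero]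

theorem imul_conjTranspose_bsMatrix_bsMatrix {η : ℝ} (h0 : 0 ≤ η) (h1 : η ≤ 1) :
    imul (bsMatrix η)ᴴ (bsMatrix η) = 1 := by
  ext c d
  rw [imul, tsum_eq_sum (s := antidiagonal (d.1 + d.2)), Matrix.one_apply,
    ← sum_antidiagonal_bsMatrix_mul h0 h1]
  · refine Finset.sum_congr rfl fun a _ => ?_
    rw [Matrix.conjTranspose_apply, ← starRingEnd_apply, conj_bsMatrix]
  · intro a ha
    rw [bsMatrix_eq_zero η (a := a) (b := d) (by simpa using ha), mul_zero]

theorem imul_bsMatrix_conjTranspose_bsMatrix {η : ℝ} (h0 : 0 ≤ η) (h1 : η ≤ 1) :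
    imul (bsMatrix η) (bsMatrix η)ᴴ = 1 := by
  ext a b
  rw [imul, tsum_eq_sum (s := antidiagonal (a.1 + a.2)), Matrix.one_apply,
    ← sum_antidiagonal_bsMatrix_mul' h0 h1]
  · refine Finset.sum_congr rfl fun c _ => ?_
    rw [Matrix.conjTranspose_apply, ← starRingEnd_apply, conj_bsMatrix]
  · intro c hc
    rw [bsMatrix_eq_zero η (a := a) (b := c) (by rw [mem_antidiagonal] at hc; omega),
      zero_mul]

/-! ### The joint output -/

/-- Conservation of photon number truncates both infinite matrix products to finite sums. -/
theorem jointOutput_apply (η : ℝ) (ρX ρY : Matrix ℕ ℕ ℂ) (a b : ℕ × ℕ) :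
    jointOutput η ρX ρY a b = ∑ c ∈ antidiagonal (a.1 + a.2),
      ∑ d ∈ antidiagonal (b.1 + b.2),
        bsMatrix η a c * (ρX ⊗ₖ ρY) c d * bsMatrix η b d := by
  have h : ∀ d, imul (bsMatrix η) (ρX ⊗ₖ ρY) a d =
      ∑ c ∈ antidiagonal (a.1 + a.2), bsMatrix η a c * (ρX ⊗ₖ ρY) c d := fun d => by
    rw [imul, tsum_eq_sum]
    intro c hc
    rw [bsMatrix_eq_zero η (a := a) (b := c) (by rw [mem_antidiagonal] at hc; omega),
      zero_mul]
  rw [jointOutput, imul, tsum_eq_sum (s := antidiagonal (b.1 + b.2)), Finset.sum_comm]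
  · refine Finset.sum_congr rfl fun d _ => ?_
    rw [h, Finset.sum_mul, Matrix.conjTranspose_apply, ← starRingEnd_apply, conj_bsMatrix]
  · intro d hd
    rw [Matrix.conjTranspose_apply,
      bsMatrix_eq_zero η (a := b) (b := d) (by rw [mem_antidiagonal] at hd; omega),
      star_zero, mul_zero]

theorem jointOutput_apply_of_subset (η : ℝ) (ρX ρY : Matrix ℕ ℕ ℂ) (a b : ℕ × ℕ)
    {s t : Finset (ℕ × ℕ)} (hs : antidiagonal (a.1 + a.2) ⊆ s)
    (ht : antidiagonal (b.1 + b.2) ⊆ t) :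
    jointOutput η ρX ρY a b = ∑ c ∈ s, ∑ d ∈ t,
      bsMatrix η a c * (ρX ⊗ₖ ρY) c d * bsMatrix η b d := by
  rw [jointOutput_apply]
  refine (Finset.sum_congr rfl fun c _ => Finset.sum_subset ht fun d _ hd => ?_).trans
    (Finset.sum_subset hs fun c _ hc => Finset.sum_eq_zero fun d _ => ?_)
  · rw [bsMatrix_eq_zero η (a := b) (b := d) (by rw [mem_antidiagonal] at hd; omega),
      mul_zero]
  · rw [bsMatrix_eq_zero η (a := a) (b := c) (by rw [mem_antidiagonal] at hc; omega),
      zero_mul, zero_mul]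

/-- A quadratic form in the joint output is one in the joint input. -/
theorem sum_sum_jointOutput (η : ℝ) (ρX ρY : Matrix ℕ ℕ ℂ) (x : ℕ × ℕ → ℂ)
    {s t S T : Finset (ℕ × ℕ)} (hs : ∀ a ∈ s, antidiagonal (a.1 + a.2) ⊆ S)
    (ht : ∀ a ∈ t, antidiagonal (a.1 + a.2) ⊆ T) :
    ∑ a ∈ s, ∑ b ∈ t, conj (x a) * jointOutput η ρX ρY a b * x b =
      ∑ c ∈ S, ∑ d ∈ T, conj (∑ a ∈ s, bsMatrix η a c * x a) * (ρX ⊗ₖ ρY) c d *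
        ∑ b ∈ t, bsMatrix η b d * x b := by
  calc _ = ∑ a ∈ s, ∑ b ∈ t, ∑ c ∈ S, ∑ d ∈ T,
        conj (x a) * (bsMatrix η a c * (ρX ⊗ₖ ρY) c d * bsMatrix η b d) * x b := by
        refine Finset.sum_congr rfl fun a ha => Finset.sum_congr rfl fun b hb => ?_
        rw [jointOutput_apply_of_subset η ρX ρY a b (hs a ha) (ht b hb)]
        simp_rw [Finset.mul_sum, Finset.sum_mul]
    _ = ∑ c ∈ S, ∑ d ∈ T, ∑ a ∈ s, ∑ b ∈ t,
        conj (x a) * (bsMatrix η a c * (ρX ⊗ₖ ρY) c d * bsMatrix η b d) * x b := by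
        rw [Finset.sum_congr rfl fun a _ => Finset.sum_comm, Finset.sum_comm]
        refine Finset.sum_congr rfl fun c _ => ?_
        rw [Finset.sum_congr rfl fun a _ => Finset.sum_comm, Finset.sum_comm]
    _ = _ := by
        refine Finset.sum_congr rfl fun c _ => Finset.sum_congr rfl fun d _ => ?_
        simp_rw [map_sum, map_mul, conj_bsMatrix, Finset.mul_sum, Finset.sum_mul]
        rw [Finset.sum_comm]
        refine Finset.sum_congr rfl fun a _ => Finset.sum_congr rfl fun b _ => ?_
        ring

theorem jointOutput_posSemidef (η : ℝ) {ρX ρY : Matrix ℕ ℕ ℂ} (hX : ρX.PosSemidef)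
    (hY : ρY.PosSemidef) : (jointOutput η ρX ρY).PosSemidef := by
  have hR := kronecker_posSemidef hX hY
  refine posSemidef_iff_sum_nonneg.2 ⟨Matrix.ext fun a b => ?_, fun s x => ?_⟩
  · rw [Matrix.conjTranspose_apply, jointOutput_apply, jointOutput_apply, Finset.sum_comm,
      ← starRingEnd_apply]
    simp_rw [map_sum, map_mul, conj_bsMatrix]
    refine Finset.sum_congr rfl fun c _ => Finset.sum_congr rfl fun d _ => ?_
    have : conj ((ρX ⊗ₖ ρY) d c) = (ρX ⊗ₖ ρY) c d := hR.1.apply c d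
    rw [this]
    ring
  · have hS : ∀ a ∈ s, antidiagonal (a.1 + a.2) ⊆
        s.biUnion fun a => antidiagonal (a.1 + a.2) := fun a ha =>
      Finset.subset_biUnion_of_mem (fun a : ℕ × ℕ => antidiagonal (a.1 + a.2)) ha
    rw [sum_sum_jointOutput η ρX ρY x hS hS]
    exact (posSemidef_iff_sum_nonneg.1 hR).2 _ _

/-- Cyclicity of the trace, block by block. -/
theorem sum_antidiagonal_jointOutput {η : ℝ} (h0 : 0 ≤ η) (h1 : η ≤ 1) (ρX ρY : Matrix ℕ ℕ ℂ)
    (N : ℕ) : ∑ a ∈ antidiagonal N, jointOutput η ρX ρY a a =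
      ∑ a ∈ antidiagonal N, (ρX ⊗ₖ ρY) a a := by
  calc _ = ∑ a ∈ antidiagonal N, ∑ c ∈ antidiagonal N,
        ∑ d ∈ antidiagonal N, bsMatrix η a c * (ρX ⊗ₖ ρY) c d * bsMatrix η a d := by
        refine Finset.sum_congr rfl fun a ha => ?_
        rw [jointOutput_apply, mem_antidiagonal.1 ha]
    _ = ∑ c ∈ antidiagonal N, ∑ d ∈ antidiagonal N, (ρX ⊗ₖ ρY) c d *
        ∑ a ∈ antidiagonal N, bsMatrix η a c * bsMatrix η a d := by
        rw [Finset.sum_comm]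
        refine Finset.sum_congr rfl fun c _ => ?_
        rw [Finset.sum_comm]
        refine Finset.sum_congr rfl fun d _ => ?_
        rw [Finset.mul_sum]
        refine Finset.sum_congr rfl fun a _ => ?_
        ring
    _ = _ := by
        refine Finset.sum_congr rfl fun c hc => ?_
        rw [Finset.sum_eq_single_of_mem c hc]
        · have h := sum_antidiagonal_bsMatrix_mul h0 h1 c c
          rw [mem_antidiagonal.1 hc, if_pos rfl] at h
          rw [h, mul_one]
        · intro d hd hdc
          have h := sum_antidiagonal_bsMatrix_mul h0 h1 c d
          rw [mem_antidiagonal.1 hd, if_neg hdc.symm] at h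
          rw [h, mul_zero]

theorem IsDensity.jointOutput {η : ℝ} (h0 : 0 ≤ η) (h1 : η ≤ 1) {ρX ρY : Matrix ℕ ℕ ℂ}
    (hX : IsDensity ρX) (hY : IsDensity ρY) : IsDensity (jointOutput η ρX ρY) := by
  have hR := hX.kronecker hY
  have hT := jointOutput_posSemidef η hX.1 hY.1
  refine ⟨hT, ?_⟩
  have hre : ∀ a, NumberMixing.jointOutput η ρX ρY a a =
      ((NumberMixing.jointOutput η ρX ρY a a).re : ℂ) := fun a =>
    Complex.ext (by simp) (by simpa using (Complex.nonneg_iff.1 (hT.diag_nonneg (i := a))).2.symm)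
  -- Equality of block sums transfers summability only for nonnegative terms, so it is settled for
  -- real parts before the complex traces are compared.
  have hs : Summable fun a => (NumberMixing.jointOutput η ρX ρY a a).re := by
    refine summable_of_antidiagonal_sum_eq hR.diag_re_nonneg
      (fun a => (Complex.nonneg_iff.1 (hT.diag_nonneg (i := a))).1) (fun N => ?_)
      hR.hasSum_re.summable
    rw [← Complex.re_sum, ← Complex.re_sum, sum_antidiagonal_jointOutput h0 h1]
  have hs' : Summable fun a => NumberMixing.jointOutput η ρX ρY a a := by
    rw [show (fun a => NumberMixing.jointOutput η ρX ρY a a) = _ from funext hre]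
    exact Complex.summable_ofReal.2 hs
  have := tsum_eq_of_antidiagonal_sum_eq hs' hR.2.summable
    (sum_antidiagonal_jointOutput h0 h1 ρX ρY)
  rw [hR.2.tsum_eq] at this
  exact this ▸ hs'.hasSum

theorem IsDensity.output {η : ℝ} (h0 : 0 ≤ η) (h1 : η ≤ 1) {ρX ρY : Matrix ℕ ℕ ℂ}
    (hX : IsDensity ρX) (hY : IsDensity ρY) : IsDensity (output η ρX ρY) :=
  (hX.jointOutput h0 h1 hY).partialTrace

end NumberMixing

/-! ### Coherent states, Husimi functions and contraction of one mode. -/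

namespace NumberMixing

open Finset.HasAntidiagonal (antidiagonal mem_antidiagonal)

/-! ### Coherent states -/

theorem norm_coherent_sq (r : ℂ) (n : ℕ) :
    ‖coherent r n‖ ^ 2 = Real.exp (-‖r‖ ^ 2) * ‖r‖ ^ (2 * n) / (n ! : ℝ) := by
  have h : Real.exp (-‖r‖ ^ 2 / 2) ^ 2 = Real.exp (-‖r‖ ^ 2) := by
    rw [← Real.exp_nat_mul]; congr 1; push_cast; ring
  rw [coherent, norm_mul, norm_pow, Complex.norm_real, Real.norm_of_nonneg (by positivity), mul_pow,
    div_pow, Real.sq_sqrt (by positivity), h, ← pow_mul, mul_comm n 2]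
  ring

theorem hasSum_norm_coherent_sq (r : ℂ) : HasSum (fun n => ‖coherent r n‖ ^ 2) 1 := by
  have h := (NormedSpace.expSeries_div_hasSum_exp (‖r‖ ^ 2 : ℝ)).mul_left (Real.exp (-‖r‖ ^ 2))
  rw [← Real.exp_eq_exp_ℝ, ← Real.exp_add, neg_add_cancel, Real.exp_zero] at h
  refine h.congr_fun fun n => ?_
  rw [norm_coherent_sq, pow_mul, mul_div_assoc]

/-- The two-mode coherent state `|r, s⟩`. -/
noncomputable def coherent₂ (r s : ℂ) (a : ℕ × ℕ) : ℂ := coherent r a.1 * coherent s a.2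

theorem summable_norm_coherent₂_sq (r s : ℂ) : Summable fun a => ‖coherent₂ r s a‖ ^ 2 := by
  refine ((hasSum_norm_coherent_sq r).summable.mul_of_nonneg (hasSum_norm_coherent_sq s).summable
    (fun _ => by positivity) (fun _ => by positivity)).congr fun a => ?_
  rw [coherent₂, norm_mul, mul_pow]

theorem coherent₂_eq (r s : ℂ) (a : ℕ × ℕ) : coherent₂ r s a =
    ((Real.exp (-(‖r‖ ^ 2 + ‖s‖ ^ 2) / 2) : ℝ) : ℂ) * bargmann r s (ket a) := by
  have h : Real.exp (-(‖r‖ ^ 2 + ‖s‖ ^ 2) / 2) =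
      Real.exp (-‖r‖ ^ 2 / 2) * Real.exp (-‖s‖ ^ 2 / 2) := by
    rw [← Real.exp_add]; congr 1; ring
  rw [coherent₂, coherent, coherent, bargmann_ket, h, Real.sqrt_mul (by positivity)]
  push_cast
  ring

/-- Keeps the Gaussian normalisation of a two-mode coherent state unchanged under the rotation of
its amplitudes. -/
theorem norm_sq_rotate {η : ℝ} (h0 : 0 ≤ η) (h1 : η ≤ 1) (r s : ℂ) :
    ‖((√η : ℝ) : ℂ) * r - ((√(1 - η) : ℝ) : ℂ) * s‖ ^ 2 +
      ‖((√(1 - η) : ℝ) : ℂ) * r + ((√η : ℝ) : ℂ) * s‖ ^ 2 = ‖r‖ ^ 2 + ‖s‖ ^ 2 := by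
  have e1 := Real.sq_sqrt h0
  have e2 := Real.sq_sqrt (show 0 ≤ 1 - η by linarith)
  simp only [Complex.sq_norm, Complex.normSq_apply, Complex.add_re, Complex.sub_re, Complex.mul_re,
    Complex.ofReal_re, Complex.ofReal_im, Complex.add_im, Complex.sub_im, Complex.mul_im]
  have e : √η ^ 2 + √(1 - η) ^ 2 = 1 := by rw [e1, e2]; ring
  linear_combination (r.re ^ 2 + r.im ^ 2 + s.re ^ 2 + s.im ^ 2) * e

/-- The adjoint of the beamsplitter maps coherent states to coherent states. -/
theorem sum_bsMatrix_coherent₂ {η : ℝ} (h0 : 0 ≤ η) (h1 : η ≤ 1) (r s : ℂ) (c : ℕ × ℕ) :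
    ∑ a ∈ antidiagonal (c.1 + c.2), bsMatrix η a c * coherent₂ r s a =
      coherent₂ (((√η : ℝ) : ℂ) * r - ((√(1 - η) : ℝ) : ℂ) * s)
        (((√(1 - η) : ℝ) : ℂ) * r + ((√η : ℝ) : ℂ) * s) c := by
  have h := bargmann_beamsplitter η r s (ket c)
  have hsub : (beamsplitter η (ket c)).support ⊆ antidiagonal (c.1 + c.2) := by
    intro a ha
    rw [mem_antidiagonal]
    by_contra h'
    exact (Finsupp.mem_support_iff.1 ha) (bsMatrix_eq_zero η h')
  rw [coherent₂_eq, ← h, norm_sq_rotate h0 h1, bargmann, Finsupp.linearCombination_apply,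
    Finsupp.sum_of_support_subset _ hsub _ (by simp), Finset.mul_sum]
  refine Finset.sum_congr rfl fun a _ => ?_
  rw [coherent₂_eq, bargmann_ket, smul_eq_mul, bsMatrix]
  ring

/-! ### Husimi functions of states -/

theorem IsDensity.summable_norm_husimiTerm {ρ : Matrix ℕ ℕ ℂ} (h : IsDensity ρ) (r : ℂ) :
    Summable fun a => ‖husimiTerm ρ r a‖ :=
  h.summable_norm_quadTerm (hasSum_norm_coherent_sq r).summable

/-- Nonnegativity in the order of `ℂ` includes reality, so the real part in `husimi` discards
nothing. -/
theorem tsum_husimiTerm_of_nonneg {ρ : Matrix ℕ ℕ ℂ} {r : ℂ} (h : 0 ≤ ∑' a, husimiTerm ρ r a) :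
    ((Real.pi * husimi ρ r : ℝ) : ℂ) = ∑' a, husimiTerm ρ r a := by
  rw [husimi, ← mul_assoc, mul_one_div_cancel Real.pi_ne_zero, one_mul]
  exact Complex.ext (by simp) (by simpa using (Complex.nonneg_iff.1 h).2)

theorem IsDensity.tsum_husimiTerm_nonneg {ρ : Matrix ℕ ℕ ℂ} (h : IsDensity ρ) (r : ℂ) :
    0 ≤ ∑' a, husimiTerm ρ r a :=
  tsum_quadTerm_nonneg h.1 (h.summable_norm_husimiTerm r).of_norm

theorem IsDensity.hasSum_husimiTerm {ρ : Matrix ℕ ℕ ℂ} (h : IsDensity ρ) (r : ℂ) :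
    HasSum (husimiTerm ρ r) ((Real.pi * husimi ρ r : ℝ) : ℂ) := by
  rw [tsum_husimiTerm_of_nonneg (h.tsum_husimiTerm_nonneg r)]
  exact (h.summable_norm_husimiTerm r).of_norm.hasSum

theorem husimi_nonneg_of_tsum {ρ : Matrix ℕ ℕ ℂ} {r : ℂ} (h : 0 ≤ ∑' a, husimiTerm ρ r a) :
    0 ≤ husimi ρ r :=
  mul_nonneg (by positivity) (Complex.nonneg_iff.1 h).1

theorem IsDensity.husimi_nonneg {ρ : Matrix ℕ ℕ ℂ} (h : IsDensity ρ) (r : ℂ) : 0 ≤ husimi ρ r :=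
  husimi_nonneg_of_tsum (h.tsum_husimiTerm_nonneg r)

/-! ### The joint output on two-mode coherent states -/

theorem tsum_eq_of_fiber_sum_eq {β γ : Type*} {f g : β → ℂ} (hf : Summable f) (hg : Summable g)
    (p : β → γ) (S : γ → Finset β) (hS : ∀ b c, b ∈ S c ↔ p b = c)
    (h : ∀ c, ∑ b ∈ S c, f b = ∑ b ∈ S c, g b) : ∑' b, f b = ∑' b, g b := by
  have e : ∀ {f : β → ℂ}, Summable f → ∑' b, f b = ∑' c, ∑ b ∈ S c, f b := fun {f} hf => by
    rw [← (hf.hasSum.tsum_fiberwise p).tsum_eq]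
    refine tsum_congr fun c => ?_
    have : p ⁻¹' {c} = (S c : Set β) := by ext b; simp [hS]
    rw [this, Finset.tsum_subtype' (S c) f]
  rw [e hf, e hg]
  exact tsum_congr h

theorem tsum_quadTerm_kronecker {ρX ρY : Matrix ℕ ℕ ℂ} (hX : IsDensity ρX) (hY : IsDensity ρY)
    (r s : ℂ) : ∑' p, quadTerm (ρX ⊗ₖ ρY) (coherent₂ r s) p =
      (∑' a, husimiTerm ρX r a) * ∑' a, husimiTerm ρY s a := by
  rw [tsum_mul_tsum_of_summable_norm (hX.summable_norm_husimiTerm r)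
    (hY.summable_norm_husimiTerm s), ← (Equiv.prodProdProdComm ℕ ℕ ℕ ℕ).tsum_eq]
  refine tsum_congr fun p => ?_
  simp only [quadTerm, husimiTerm, coherent₂, Equiv.prodProdProdComm_apply, map_mul,
    Matrix.kroneckerMap_apply]
  ring

/-- Grouping by the total photon numbers of bra and ket makes each group finite; there the
beamsplitter moves onto the coherent vectors and rotates them, leaving a form in a product state. -/
theorem tsum_quadTerm_jointOutput {η : ℝ} (h0 : 0 ≤ η) (h1 : η ≤ 1) {ρX ρY : Matrix ℕ ℕ ℂ}
    (hX : IsDensity ρX) (hY : IsDensity ρY) (r s : ℂ) :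
    ∑' p, quadTerm (jointOutput η ρX ρY) (coherent₂ r s) p =
      (∑' a, husimiTerm ρX (((√η : ℝ) : ℂ) * r - ((√(1 - η) : ℝ) : ℂ) * s) a) *
        ∑' a, husimiTerm ρY (((√(1 - η) : ℝ) : ℂ) * r + ((√η : ℝ) : ℂ) * s) a := by
  rw [← tsum_quadTerm_kronecker hX hY]
  refine tsum_eq_of_fiber_sum_eq
    ((hX.jointOutput h0 h1 hY).summable_norm_quadTerm (summable_norm_coherent₂_sq r s)).of_norm
    ((hX.kronecker hY).summable_norm_quadTerm (summable_norm_coherent₂_sq _ _)).of_norm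
    (fun p => (p.1.1 + p.1.2, p.2.1 + p.2.2))
    (fun N => antidiagonal N.1 ×ˢ antidiagonal N.2) ?_ ?_
  · rintro p ⟨M, N⟩
    simp [Prod.ext_iff]
  · rintro ⟨M, N⟩
    rw [Finset.sum_product, Finset.sum_product]
    have h := sum_sum_jointOutput η ρX ρY (coherent₂ r s) (s := antidiagonal M)
      (t := antidiagonal N) (S := antidiagonal M) (T := antidiagonal N)
      (fun a ha => by rw [mem_antidiagonal.1 ha]) (fun a ha => by rw [mem_antidiagonal.1 ha])
    refine h.trans (Finset.sum_congr rfl fun c hc => Finset.sum_congr rfl fun d hd => ?_)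
    have e1 := sum_bsMatrix_coherent₂ h0 h1 r s c
    have e2 := sum_bsMatrix_coherent₂ h0 h1 r s d
    rw [mem_antidiagonal.1 hc] at e1
    rw [mem_antidiagonal.1 hd] at e2
    rw [e1, e2, quadTerm]

/-! ### Contraction of the first mode with a coherent state -/

/-- The matrix `⟨r| T |r⟩` on the second mode, for the coherent state `|r⟩` of the first. -/
noncomputable def contract (T : Matrix (ℕ × ℕ) (ℕ × ℕ) ℂ) (r : ℂ) : Matrix ℕ ℕ ℂ :=
  fun k k' => ∑' a : ℕ × ℕ, conj (coherent r a.1) * T (a.1, k) (a.2, k') * coherent r a.2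

/-- Fubini for an absolutely convergent series. It feeds `lintegral_husimi`, which avoids
`IsDensity` because a contracted matrix is not normalised. -/
theorem summable_and_tsum_contract_husimiTerm {T : Matrix (ℕ × ℕ) (ℕ × ℕ) ℂ} (hT : IsDensity T) (r s : ℂ) :
    (Summable fun a => ‖husimiTerm (contract T r) s a‖) ∧
      ∑' a, husimiTerm (contract T r) s a = ∑' p, quadTerm T (coherent₂ r s) p := by
  have hF := hT.summable_norm_quadTerm (summable_norm_coherent₂_sq r s)
  rw [← (Equiv.prodProdProdComm ℕ ℕ ℕ ℕ).summable_iff,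
    ← (Equiv.prodComm (ℕ × ℕ) (ℕ × ℕ)).summable_iff] at hF
  have e : ∀ k : ℕ × ℕ, ∑' a : ℕ × ℕ, quadTerm T (coherent₂ r s) ((a.1, k.1), (a.2, k.2)) =
      husimiTerm (contract T r) s k := fun k => by
    rw [husimiTerm, contract, ← tsum_mul_left, ← tsum_mul_right]
    refine tsum_congr fun a => ?_
    simp only [quadTerm, coherent₂, map_mul]
    ring
  have hF' : Summable fun x : (ℕ × ℕ) × (ℕ × ℕ) =>
      ‖quadTerm T (coherent₂ r s) ((x.2.1, x.1.1), (x.2.2, x.1.2))‖ := hF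
  constructor
  · refine Summable.of_nonneg_of_le (fun _ => norm_nonneg _) (fun k => ?_) hF'.prod
    rw [← e]
    exact norm_tsum_le_tsum_norm (hF'.prod_factor k)
  · rw [← (Equiv.prodProdProdComm ℕ ℕ ℕ ℕ).tsum_eq (quadTerm T (coherent₂ r s)),
      ← (Equiv.prodComm (ℕ × ℕ) (ℕ × ℕ)).tsum_eq]
    refine Eq.trans ?_ (hF'.of_norm.tsum_prod).symm
    exact tsum_congr fun k => (e k).symm

/-- The second-mode index is shared by bra and ket, so the crosswise bound involves only diagonal
entries of `T` times coherent weights, summable over all three indices. -/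
theorem IsDensity.summable_contract_diag {T : Matrix (ℕ × ℕ) (ℕ × ℕ) ℂ} (hT : IsDensity T)
    (r : ℂ) : Summable fun x : ℕ × (ℕ × ℕ) =>
      ‖conj (coherent r x.2.1) * T (x.2.1, x.1) (x.2.2, x.1) * coherent r x.2.2‖ := by
  have hc := (hasSum_norm_coherent_sq r).summable
  have ht := hT.hasSum_re.summable
  have h1 := hc.mul_of_nonneg ht (fun _ => by positivity) hT.diag_re_nonneg
  have h2 : Summable fun x : ℕ × (ℕ × ℕ) =>
      ‖coherent r x.2.1‖ ^ 2 * (T (x.2.2, x.1) (x.2.2, x.1)).re :=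
    h1.comp_injective (i := fun x : ℕ × (ℕ × ℕ) => (x.2.1, (x.2.2, x.1))) (by
      rintro ⟨a, b, c⟩ ⟨a', b', c'⟩ h
      simp only [Prod.mk.injEq] at h ⊢
      tauto)
  have h3 : Summable fun x : ℕ × (ℕ × ℕ) =>
      (T (x.2.1, x.1) (x.2.1, x.1)).re * ‖coherent r x.2.2‖ ^ 2 := by
    refine (h1.comp_injective (i := fun x : ℕ × (ℕ × ℕ) => (x.2.2, (x.2.1, x.1))) (by
      rintro ⟨a, b, c⟩ ⟨a', b', c'⟩ h
      simp only [Prod.mk.injEq] at h ⊢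
      tauto)).congr fun x => ?_
    simp only [Function.comp_apply]
    ring
  refine Summable.of_nonneg_of_le (fun _ => norm_nonneg _) (fun x => ?_)
    ((h2.add h3).div_const 2)
  exact norm_quadTerm_le (hT.1.submatrix fun j : ℕ => (j, x.1)) (coherent r) x.2

/-- Contracting the first mode and tracing the second may be done in either order. -/
theorem IsDensity.hasSum_contract_diag {T : Matrix (ℕ × ℕ) (ℕ × ℕ) ℂ} (hT : IsDensity T)
    (r : ℂ) : HasSum (fun k => contract T r k k)
      (∑' a, husimiTerm (NumberMixing.partialTrace T) r a) := by
  have hF := hT.summable_contract_diag r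
  have h1 := hF.of_norm.hasSum.prod_fiberwise fun k => (hF.prod_factor k).of_norm.hasSum
  suffices e : ∑' a, husimiTerm (NumberMixing.partialTrace T) r a = ∑' x : ℕ × (ℕ × ℕ),
      conj (coherent r x.2.1) * T (x.2.1, x.1) (x.2.2, x.1) * coherent r x.2.2 by
    rw [e]; exact h1
  rw [← (Equiv.prodComm ℕ (ℕ × ℕ)).symm.tsum_eq]
  have hF2 := (Equiv.prodComm ℕ (ℕ × ℕ)).symm.summable_iff.2 hF.of_norm
  refine Eq.trans (tsum_congr fun a => ?_) (Summable.tsum_prod hF2).symm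
  simp only [Function.comp_apply, Equiv.prodComm_symm, Equiv.prodComm_apply, Prod.swap_prod_mk]
  rw [tsum_mul_right, tsum_mul_left, husimiTerm, NumberMixing.partialTrace]

theorem IsDensity.contract_diag_nonneg {T : Matrix (ℕ × ℕ) (ℕ × ℕ) ℂ} (hT : IsDensity T)
    (r : ℂ) (k : ℕ) : 0 ≤ contract T r k k :=
  tsum_quadTerm_nonneg (hT.1.submatrix fun j : ℕ => (j, k))
    ((hT.summable_contract_diag r).prod_factor k).of_norm

end NumberMixing

/-! ### Angular Fourier analysis: total mass and circular symmetry. -/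

namespace NumberMixing

/-! ### Gaussian moments in the plane -/

theorem integral_norm_pow_mul_exp (k : ℕ) :
    ∫ r : ℂ, Real.exp (-‖r‖ ^ 2) * ‖r‖ ^ (2 * k) = Real.pi * (k ! : ℝ) := by
  have h := Complex.integral_rpow_mul_exp_neg_rpow (p := 2) (q := ((2 * k : ℕ) : ℝ)) (by norm_num)
    (by have : (0 : ℝ) ≤ ((2 * k : ℕ) : ℝ) := Nat.cast_nonneg _
        linarith)
  have e : ((2 * k : ℕ) + 2 : ℝ) / 2 = (k : ℝ) + 1 := by push_cast; ring
  rw [e, Real.Gamma_nat_eq_factorial, mul_div_cancel_left₀ _ (two_ne_zero' ℝ)] at h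
  rw [← h]
  congr 1
  funext r
  rw [Real.rpow_natCast, Real.rpow_two, mul_comm]

/-- The Bochner integral of a non-integrable function is zero, and this one is not. -/
theorem integrable_norm_pow_mul_exp (k : ℕ) :
    Integrable fun r : ℂ => Real.exp (-‖r‖ ^ 2) * ‖r‖ ^ (2 * k) := by
  refine not_imp_comm.1 integral_undef ?_
  rw [integral_norm_pow_mul_exp]
  positivity

theorem continuous_coherent (n : ℕ) : Continuous fun r => coherent r n := by
  unfold coherent
  fun_prop

theorem lintegral_norm_coherent_sq (n : ℕ) :
    ∫⁻ r : ℂ, ENNReal.ofReal (‖coherent r n‖ ^ 2) = ENNReal.ofReal Real.pi := by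
  simp_rw [norm_coherent_sq]
  rw [← ofReal_integral_eq_lintegral_ofReal ((integrable_norm_pow_mul_exp n).div_const _)
    (Filter.Eventually.of_forall fun r => by positivity), integral_div,
    integral_norm_pow_mul_exp, mul_div_cancel_right₀ _ (by positivity)]

/-! ### Averages over circles -/

theorem integral_exp_int_mul (m : ℤ) :
    ∫ θ in (0 : ℝ)..2 * Real.pi, Complex.exp (m * θ * Complex.I) =
      if m = 0 then (2 * Real.pi : ℂ) else 0 := by
  split_ifs with h
  · simp [h]
  · have hc : (m : ℂ) * Complex.I ≠ 0 := mul_ne_zero (by exact_mod_cast h) Complex.I_ne_zero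
    have h1 := integral_exp_mul_complex (a := 0) (b := 2 * Real.pi) hc
    have h2 : Complex.exp ((m : ℂ) * Complex.I * ((2 * Real.pi : ℝ) : ℂ)) = 1 :=
      Complex.exp_eq_one_iff.2 ⟨m, by push_cast; ring⟩
    rw [h2] at h1
    simp only [Complex.ofReal_zero, mul_zero, Complex.exp_zero, sub_self, zero_div] at h1
    rw [← h1]
    refine intervalIntegral.integral_congr fun θ _ => congrArg Complex.exp ?_
    ring

/-- The `d`-th Fourier coefficient of an absolutely convergent double series. -/
theorem integral_tsum_circle {a : ℕ × ℕ → ℂ} (ha : Summable fun x => ‖a x‖) (d : ℕ) :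
    ∫ θ in (0 : ℝ)..2 * Real.pi, (∑' x : ℕ × ℕ,
      a x * Complex.exp (((x.2 : ℤ) - (x.1 : ℤ) - (d : ℤ) : ℤ) * θ * Complex.I)) =
      2 * Real.pi * ∑' j, a (j, j + d) := by
  have hpi : (0 : ℝ) ≤ 2 * Real.pi := by positivity
  have hnorm : ∀ (x : ℕ × ℕ) (θ : ℝ), ‖a x *
      Complex.exp (((x.2 : ℤ) - (x.1 : ℤ) - (d : ℤ) : ℤ) * θ * Complex.I)‖ = ‖a x‖ := fun x θ => by
    have : (((x.2 : ℤ) - (x.1 : ℤ) - (d : ℤ) : ℤ) : ℂ) * θ * Complex.I =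
        ((((x.2 : ℤ) - (x.1 : ℤ) - (d : ℤ) : ℤ) * θ : ℝ) : ℂ) * Complex.I := by push_cast; ring
    rw [norm_mul, this, Complex.norm_exp_ofReal_mul_I, mul_one]
  have h := hasSum_integral_of_summable_integral_norm
    (μ := volume.restrict (Set.Ioc 0 (2 * Real.pi)))
    (F := fun (x : ℕ × ℕ) (θ : ℝ) =>
      a x * Complex.exp (((x.2 : ℤ) - (x.1 : ℤ) - (d : ℤ) : ℤ) * θ * Complex.I))
    (fun x => by
      have hc : Continuous fun θ : ℝ =>
          a x * Complex.exp (((x.2 : ℤ) - (x.1 : ℤ) - (d : ℤ) : ℤ) * θ * Complex.I) := by fun_prop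
      exact (hc.integrableOn_Icc).mono_set Set.Ioc_subset_Icc_self)
    (by
      simp_rw [hnorm, integral_const]
      exact ha.const_smul _)
  rw [intervalIntegral.integral_of_le hpi, ← h.tsum_eq, ← tsum_mul_left]
  simp_rw [← intervalIntegral.integral_of_le hpi, intervalIntegral.integral_const_mul,
    integral_exp_int_mul]
  have hinj : Function.Injective fun j : ℕ => (j, j + d) := fun i j h => (Prod.mk.inj h).1
  rw [← hinj.tsum_eq]
  · refine tsum_congr fun j => ?_
    rw [if_pos (by push_cast; ring), mul_comm]
  · rintro ⟨i, j⟩ hx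
    rw [Function.mem_support] at hx
    have h0 : (j : ℤ) - (i : ℤ) - (d : ℤ) = 0 := by
      by_contra h'
      exact hx (by rw [if_neg h', mul_zero])
    exact ⟨i, Prod.ext rfl (by dsimp only; omega)⟩

theorem coherent_rotate (θ : ℝ) (r : ℂ) (n : ℕ) :
    coherent (Complex.exp (θ * Complex.I) * r) n =
      Complex.exp (n * θ * Complex.I) * coherent r n := by
  rw [coherent, coherent, norm_mul, Complex.norm_exp_ofReal_mul_I, one_mul, mul_pow,
    ← Complex.exp_nat_mul]
  ring_nf

/-- The phase depends only on the difference of the indices, so each angular Fourier coefficient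
isolates one diagonal of the matrix. -/
theorem husimiTerm_rotate (ρ : Matrix ℕ ℕ ℂ) (θ : ℝ) (r : ℂ) (x : ℕ × ℕ) :
    husimiTerm ρ (Complex.exp (θ * Complex.I) * r) x = husimiTerm ρ r x *
      Complex.exp (((x.2 : ℤ) - (x.1 : ℤ) : ℤ) * θ * Complex.I) := by
  have h : Complex.exp (((x.2 : ℤ) - (x.1 : ℤ) : ℤ) * θ * Complex.I) =
      conj (Complex.exp (x.1 * θ * Complex.I)) * Complex.exp (x.2 * θ * Complex.I) := by
    rw [← Complex.exp_conj, ← Complex.exp_add]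
    congr 1
    simp only [map_mul, Complex.conj_ofReal, Complex.conj_I, Complex.conj_natCast]
    push_cast
    ring
  rw [husimiTerm, husimiTerm, coherent_rotate, coherent_rotate, map_mul, h]
  ring

/-! ### The total mass of a Husimi function -/

theorem measurable_husimi {M : Matrix ℕ ℕ ℂ} (h : ∀ r, Summable fun a => ‖husimiTerm M r a‖) :
    Measurable (husimi M) := by
  have h1 : Measurable fun r => ∑' a, husimiTerm M r a := by
    refine measurable_of_tendsto_metrizable' Filter.atTop
      (f := fun (s : Finset (ℕ × ℕ)) r => ∑ a ∈ s, husimiTerm M r a) (fun s => ?_)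
      (tendsto_pi_nhds.2 fun r => (h r).of_norm.hasSum)
    refine Continuous.measurable (continuous_finsetSum _ fun a _ => ?_)
    have c1 := continuous_coherent a.1
    have c2 := continuous_coherent a.2
    exact ((Complex.continuous_conj.comp c1).mul continuous_const).mul c2
  exact (Complex.measurable_re.comp h1).const_mul _

theorem husimiTerm_diag_eq {M : Matrix ℕ ℕ ℂ} {r : ℂ} (hM : ∀ k, 0 ≤ M k k)
    (k : ℕ) : husimiTerm M r (k, k) = (((M k k).re * ‖coherent r k‖ ^ 2 : ℝ) : ℂ) := by
  have h : M k k = ((M k k).re : ℂ) :=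
    Complex.ext (by simp) (by simpa using (Complex.nonneg_iff.1 (hM k)).2.symm)
  rw [husimiTerm, h, mul_right_comm, ← Complex.normSq_eq_conj_mul_self, Complex.normSq_eq_norm_sq,
    Complex.ofReal_re]
  push_cast
  ring

theorem integral_husimi_circle {M : Matrix ℕ ℕ ℂ} {r : ℂ}
    (h : Summable fun a => ‖husimiTerm M r a‖)
    (hn : ∀ r, 0 ≤ ∑' a, husimiTerm M r a) (hM : ∀ k, 0 ≤ M k k) :
    ∫ θ in (0 : ℝ)..2 * Real.pi, husimi M (Complex.exp (θ * Complex.I) * r) =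
      2 * ∑' k, (M k k).re * ‖coherent r k‖ ^ 2 := by
  have h1 := integral_tsum_circle h 0
  simp only [Nat.cast_zero, sub_zero, add_zero, ← husimiTerm_rotate,
    husimiTerm_diag_eq hM, ← tsum_husimiTerm_of_nonneg (hn _)] at h1
  rw [intervalIntegral.integral_ofReal, ← Complex.ofReal_tsum, intervalIntegral.integral_const_mul]
    at h1
  have h2 : Real.pi * ∫ θ in (0 : ℝ)..2 * Real.pi, husimi M (Complex.exp (θ * Complex.I) * r) =
      2 * Real.pi * ∑' k, (M k k).re * ‖coherent r k‖ ^ 2 := by exact_mod_cast h1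
  refine mul_left_cancel₀ Real.pi_ne_zero (h2.trans ?_)
  ring

theorem lintegral_comp_rotate (g : ℂ → ENNReal) (θ : ℝ) :
    ∫⁻ r, g (Complex.exp (θ * Complex.I) * r) = ∫⁻ r, g r := by
  have h := (rotation (Circle.exp θ)).measurePreserving
  have h2 := h.lintegral_comp_emb
    (rotation (Circle.exp θ)).toHomeomorph.measurableEmbedding g
  simpa [rotation_apply, Circle.coe_exp] using h2

/-- The mass of a nonnegative Husimi function is the trace. -/
theorem lintegral_husimi {M : Matrix ℕ ℕ ℂ} (h : ∀ r, Summable fun a => ‖husimiTerm M r a‖)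
    (hn : ∀ r, 0 ≤ ∑' a, husimiTerm M r a) (hM : ∀ k, 0 ≤ M k k) :
    ∫⁻ r, ENNReal.ofReal (husimi M r) = ∑' k, ENNReal.ofReal (M k k).re := by
  have hm := measurable_husimi h
  have hpi : (0 : ℝ) ≤ 2 * Real.pi := by positivity
  have hMr : ∀ k, 0 ≤ (M k k).re := fun k => (Complex.nonneg_iff.1 (hM k)).1
  have hjoint : Measurable fun p : ℝ × ℂ =>
      ENNReal.ofReal (husimi M (Complex.exp (p.1 * Complex.I) * p.2)) := by
    refine ENNReal.measurable_ofReal.comp (hm.comp ?_)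
    fun_prop
  have key : ∀ r, ∫⁻ θ in Set.Ioc 0 (2 * Real.pi),
      ENNReal.ofReal (husimi M (Complex.exp (θ * Complex.I) * r)) =
      ∑' k, ENNReal.ofReal (2 * (M k k).re) * ENNReal.ofReal (‖coherent r k‖ ^ 2) := fun r => by
    have hdiag : Summable fun k => (M k k).re * ‖coherent r k‖ ^ 2 := by
      have hinj : Function.Injective fun j : ℕ => (j, j) := fun i j h => (Prod.mk.inj h).1
      refine ((h r).comp_injective hinj).congr fun k => ?_
      rw [Function.comp_apply, husimiTerm_diag_eq hM, Complex.norm_real,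
        Real.norm_of_nonneg (mul_nonneg (hMr k) (by positivity))]
    have hbd : ∀ θ : ℝ, ‖husimi M (Complex.exp (θ * Complex.I) * r)‖ ≤
        1 / Real.pi * ∑' a, ‖husimiTerm M r a‖ := fun θ => by
      rw [husimi, norm_mul, Real.norm_of_nonneg (by positivity)]
      gcongr
      refine (Complex.abs_re_le_norm _).trans ?_
      refine (norm_tsum_le_tsum_norm (h _)).trans (le_of_eq (tsum_congr fun a => ?_))
      have : (((a.2 : ℤ) - (a.1 : ℤ) : ℤ) : ℂ) * θ * Complex.I =
          ((((a.2 : ℤ) - (a.1 : ℤ) : ℤ) * θ : ℝ) : ℂ) * Complex.I := by push_cast; ring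
      rw [husimiTerm_rotate, norm_mul, this, Complex.norm_exp_ofReal_mul_I, mul_one]
    have hint : Integrable (fun θ : ℝ => husimi M (Complex.exp (θ * Complex.I) * r))
        (volume.restrict (Set.Ioc 0 (2 * Real.pi))) := by
      refine Integrable.of_bound (C := 1 / Real.pi * ∑' a, ‖husimiTerm M r a‖) ?_
        (Filter.Eventually.of_forall hbd)
      refine (hm.comp ?_).aestronglyMeasurable
      fun_prop
    rw [← ofReal_integral_eq_lintegral_ofReal hint
      (Filter.Eventually.of_forall fun θ => husimi_nonneg_of_tsum (hn _)),
      ← intervalIntegral.integral_of_le hpi, integral_husimi_circle (h r) hn hM, ← tsum_mul_left,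
      ENNReal.ofReal_tsum_of_nonneg
        (fun k => mul_nonneg zero_le_two (mul_nonneg (hMr k) (by positivity))) (hdiag.mul_left 2)]
    refine tsum_congr fun k => ?_
    rw [← mul_assoc, ENNReal.ofReal_mul (mul_nonneg zero_le_two (hMr k))]
  -- Lebesgue measure is rotation invariant, so the integral may be averaged over angles; after
  -- Tonelli the circle average retains only the diagonal, each term of which has known mass.
  have h2 : ENNReal.ofReal (2 * Real.pi) * ∫⁻ r, ENNReal.ofReal (husimi M r) =
      ENNReal.ofReal (2 * Real.pi) * ∑' k, ENNReal.ofReal (M k k).re := by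
    calc ENNReal.ofReal (2 * Real.pi) * ∫⁻ r, ENNReal.ofReal (husimi M r)
        = ∫⁻ θ in Set.Ioc 0 (2 * Real.pi), ∫⁻ r,
            ENNReal.ofReal (husimi M (Complex.exp ((θ : ℝ) * Complex.I) * r)) := by
          simp_rw [lintegral_comp_rotate fun r => ENNReal.ofReal (husimi M r)]
          rw [lintegral_const, Measure.restrict_apply_univ, Real.volume_Ioc, sub_zero, mul_comm]
      _ = ∫⁻ r, ∫⁻ θ in Set.Ioc 0 (2 * Real.pi),
            ENNReal.ofReal (husimi M (Complex.exp ((θ : ℝ) * Complex.I) * r)) :=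
          lintegral_lintegral_swap hjoint.aemeasurable
      _ = ∑' k, ∫⁻ r, ENNReal.ofReal (2 * (M k k).re) * ENNReal.ofReal (‖coherent r k‖ ^ 2) := by
          simp_rw [key]
          refine lintegral_tsum fun k => Measurable.aemeasurable ?_
          exact (ENNReal.measurable_ofReal.comp
            ((continuous_coherent k).norm.pow 2).measurable).const_mul _
      _ = ENNReal.ofReal (2 * Real.pi) * ∑' k, ENNReal.ofReal (M k k).re := by
          rw [← ENNReal.tsum_mul_left]
          refine tsum_congr fun k => ?_
          rw [lintegral_const_mul, lintegral_norm_coherent_sq,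
            ← ENNReal.ofReal_mul (mul_nonneg zero_le_two (hMr k)), ← ENNReal.ofReal_mul hpi]
          · congr 1; ring
          · exact ENNReal.measurable_ofReal.comp
              (((continuous_coherent k).norm.pow 2).measurable)
  exact (ENNReal.mul_right_inj (by positivity) ENNReal.ofReal_ne_top).1 h2

theorem IsDensity.lintegral_husimi {ρ : Matrix ℕ ℕ ℂ} (h : IsDensity ρ) :
    ∫⁻ r, ENNReal.ofReal (husimi ρ r) = 1 := by
  rw [NumberMixing.lintegral_husimi h.summable_norm_husimiTerm h.tsum_husimiTerm_nonneg
    (fun k => h.1.diag_nonneg), ← ENNReal.ofReal_tsum_of_nonneg h.diag_re_nonneg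
    h.hasSum_re.summable, h.hasSum_re.tsum_eq, ENNReal.ofReal_one]

theorem IsDensity.measurable_husimi {ρ : Matrix ℕ ℕ ℂ} (h : IsDensity ρ) : Measurable (husimi ρ) :=
  NumberMixing.measurable_husimi h.summable_norm_husimiTerm

theorem IsDensity.integrable_husimi {ρ : Matrix ℕ ℕ ℂ} (h : IsDensity ρ) :
    Integrable (husimi ρ) := by
  refine (lintegral_ofReal_ne_top_iff_integrable h.measurable_husimi.aestronglyMeasurable
    (Filter.Eventually.of_forall h.husimi_nonneg)).1 ?_
  rw [h.lintegral_husimi]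
  exact ENNReal.one_ne_top

theorem IsDensity.integral_husimi {ρ : Matrix ℕ ℕ ℂ} (h : IsDensity ρ) :
    ∫ r, husimi ρ r = 1 := by
  rw [integral_eq_lintegral_of_nonneg_ae (Filter.Eventually.of_forall h.husimi_nonneg)
    h.measurable_husimi.aestronglyMeasurable, h.lintegral_husimi, ENNReal.toReal_one]

/-! ### Circular symmetry -/

/-- The positive axis accumulates at the origin, so the identity theorem applies. -/
theorem eq_zero_of_hasSum_pos {b : ℕ → ℂ} (hb : ∀ z : ℂ, Summable fun n => z ^ n * b n)
    (h : ∀ t : ℝ, 0 < t → ∑' n, (t : ℂ) ^ n * b n = 0) (n : ℕ) : b n = 0 := by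
  let p := FormalMultilinearSeries.ofScalars ℂ b
  have hp : HasFPowerSeriesAt (fun z : ℂ => ∑' n, z ^ n * b n) p 0 := by
    rw [hasFPowerSeriesAt_iff]
    refine Filter.Eventually.of_forall fun z => ?_
    simp only [p, FormalMultilinearSeries.coeff_ofScalars, smul_eq_mul, zero_add]
    exact (hb z).hasSum
  have hfreq : ∃ᶠ z in nhdsWithin (0 : ℂ) {0}ᶜ, ∑' n, z ^ n * b n = 0 := by
    have ht : Filter.Tendsto (fun t : ℝ => (t : ℂ)) (nhdsWithin 0 (Set.Ioi 0))
        (nhdsWithin (0 : ℂ) {0}ᶜ) := by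
      refine tendsto_nhdsWithin_iff.2 ⟨?_, ?_⟩
      · exact (Complex.continuous_ofReal.tendsto' 0 0 Complex.ofReal_zero).mono_left
          nhdsWithin_le_nhds
      · filter_upwards [self_mem_nhdsWithin] with t ht
        simpa using (ne_of_gt ht : t ≠ 0)
    refine ht.frequently (Filter.Eventually.frequently ?_)
    filter_upwards [self_mem_nhdsWithin] with t ht
    exact h t ht
  have h0 := hp.analyticAt.frequently_zero_iff_eventually_zero.1 hfreq
  have hp0 : p = 0 := hp.locally_zero_iff.1 h0
  have := congrArg (fun q => FormalMultilinearSeries.coeff q n) hp0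
  simp only [p, FormalMultilinearSeries.coeff_ofScalars] at this
  exact this

theorem IsDensity.norm_le_one {ι : Type*} {ρ : Matrix ι ι ℂ} (h : IsDensity ρ) (i j : ι) :
    ‖ρ i j‖ ≤ 1 := by
  have hd : ∀ i, √(ρ i i).re ≤ 1 := fun i => by
    refine Real.sqrt_le_one.2 ?_
    exact le_hasSum h.hasSum_re i fun j _ => h.diag_re_nonneg j
  exact (norm_le_of_posSemidef h.1 i j).trans
    (mul_le_one₀ (hd i) (Real.sqrt_nonneg _) (hd j))

theorem IsDensity.upper_eq_zero_of_circularlySymmetric {ρ : Matrix ℕ ℕ ℂ} (h : IsDensity ρ)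
    (hc : CircularlySymmetric (husimi ρ)) (j d : ℕ) (hd : d ≠ 0) : ρ j (j + d) = 0 := by
  -- A function constant on circles has vanishing Fourier coefficients of nonzero order.
  have h1 : ∀ r : ℂ, ∑' j, husimiTerm ρ r (j, j + d) = 0 := fun r => by
    have h2 := integral_tsum_circle (h.summable_norm_husimiTerm r) d
    have h3 : ∀ θ : ℝ, ∑' x : ℕ × ℕ, husimiTerm ρ r x *
        Complex.exp (((x.2 : ℤ) - (x.1 : ℤ) - (d : ℤ) : ℤ) * θ * Complex.I) =
        ((Real.pi * husimi ρ r : ℝ) : ℂ) * Complex.exp ((-(d : ℤ) : ℤ) * θ * Complex.I) := by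
      intro θ
      have h4 := (h.hasSum_husimiTerm (Complex.exp (θ * Complex.I) * r)).mul_right
        (Complex.exp ((-(d : ℤ) : ℤ) * θ * Complex.I))
      rw [hc _ r (Complex.norm_exp_ofReal_mul_I θ)] at h4
      rw [← h4.tsum_eq]
      refine tsum_congr fun x => ?_
      rw [husimiTerm_rotate, mul_assoc (husimiTerm ρ r x), ← Complex.exp_add]
      congr 2
      push_cast
      ring
    simp_rw [h3] at h2
    rw [intervalIntegral.integral_const_mul, integral_exp_int_mul,
      if_neg (by simpa using hd), mul_zero] at h2
    have hpi : (2 * Real.pi : ℂ) ≠ 0 := by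
      exact_mod_cast (by positivity : (2 * Real.pi : ℝ) ≠ 0)
    exact (mul_eq_zero.1 h2.symm).resolve_left hpi
  -- These are the factorial weights of the two coherent amplitudes. With `r = √t`, the series is a
  -- nonzero factor times a power series in `t` with coefficients `b`.
  let w : ℕ → ℝ := fun j => 1 / (√(j ! : ℝ) * √((j + d)! : ℝ))
  have hw : ∀ j, 0 < w j := fun j => by positivity
  let b : ℕ → ℂ := fun j => ((w j : ℝ) : ℂ) * ρ j (j + d)
  have hb : ∀ j, b j = 0 := by
    refine eq_zero_of_hasSum_pos (fun z => ?_) (fun t ht => ?_)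
    · refine Summable.of_norm_bounded (g := fun n => ‖z‖ ^ n / (n ! : ℝ))
        (Real.summable_pow_div_factorial ‖z‖) fun n => ?_
      have hf : (n ! : ℝ) ≤ √(n ! : ℝ) * √((n + d)! : ℝ) := by
        have h5 : (n ! : ℝ) ≤ ((n + d)! : ℝ) := by
          exact_mod_cast Nat.factorial_le (Nat.le_add_right n d)
        calc (n ! : ℝ) = √(n ! : ℝ) * √(n ! : ℝ) := (Real.mul_self_sqrt (by positivity)).symm
          _ ≤ _ := by gcongr
      have hwn : w n ≤ 1 / (n ! : ℝ) := one_div_le_one_div_of_le (by positivity) hf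
      rw [norm_mul, norm_pow, norm_mul, Complex.norm_real, Real.norm_of_nonneg (hw n).le,
        div_eq_mul_one_div]
      gcongr
      exact (mul_le_of_le_one_right (hw n).le (h.norm_le_one _ _)).trans hwn
    · have h5 := h1 ((√t : ℝ) : ℂ)
      let C : ℂ := ((Real.exp (-‖((√t : ℝ) : ℂ)‖ ^ 2 / 2) ^ 2 : ℝ) : ℂ) * ((√t : ℝ) : ℂ) ^ d
      have hC : C ≠ 0 := by
        refine mul_ne_zero (Complex.ofReal_ne_zero.2 (by positivity)) (pow_ne_zero _ ?_)
        exact Complex.ofReal_ne_zero.2 (Real.sqrt_pos.2 ht).ne'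
      have h6 : ∀ j, husimiTerm ρ ((√t : ℝ) : ℂ) (j, j + d) = C * ((t : ℂ) ^ j * b j) := by
        intro j
        have ht2 : (t : ℂ) ^ j = ((√t : ℝ) : ℂ) ^ j * ((√t : ℝ) : ℂ) ^ j := by
          rw [← mul_pow, ofReal_sqrt_mul_self ht.le]
        simp only [husimiTerm, coherent, C, b, w, ht2, map_mul, map_pow, Complex.conj_ofReal]
        push_cast
        ring
      simp_rw [h6] at h5
      rw [tsum_mul_left] at h5
      exact (mul_eq_zero.1 h5).resolve_left hC
  exact (mul_eq_zero.1 (hb j)).resolve_left (Complex.ofReal_ne_zero.2 (hw j).ne')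

theorem tsum_husimiTerm_of_isDiag {ρ : Matrix ℕ ℕ ℂ} (h : ρ.IsDiag) (r : ℂ) :
    ∑' a, husimiTerm ρ r a = ∑' k, husimiTerm ρ r (k, k) := by
  have hinj : Function.Injective fun j : ℕ => (j, j) := fun i j h => (Prod.mk.inj h).1
  refine (hinj.tsum_eq ?_).symm
  rintro ⟨i, j⟩ hx
  by_contra h'
  have hij : i ≠ j := by
    rintro rfl
    exact h' ⟨i, rfl⟩
  exact hx (by simp [husimiTerm, h hij])

theorem IsDensity.circularlySymmetric_iff {ρ : Matrix ℕ ℕ ℂ} (h : IsDensity ρ) :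
    CircularlySymmetric (husimi ρ) ↔ ρ.IsDiag := by
  constructor
  · intro hc i j hij
    rcases lt_or_gt_of_ne hij with hlt | hlt
    · obtain ⟨d, rfl⟩ := Nat.exists_eq_add_of_lt hlt
      exact h.upper_eq_zero_of_circularlySymmetric hc i (d + 1) (by omega)
    · obtain ⟨d, rfl⟩ := Nat.exists_eq_add_of_lt hlt
      have h0 : ρ j (j + d + 1) = 0 :=
        h.upper_eq_zero_of_circularlySymmetric hc j (d + 1) (by omega)
      rw [← h.1.1.apply, h0, star_zero]
  · intro hd u r hu
    rw [husimi, husimi, tsum_husimiTerm_of_isDiag hd, tsum_husimiTerm_of_isDiag hd]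
    simp_rw [husimiTerm_diag_eq fun k => h.1.diag_nonneg, norm_coherent_sq, norm_mul, hu,
      one_mul]

end NumberMixing

/-! ### Scaled convolution of Husimi functions and laws of scaled sums. -/

namespace NumberMixing

open scoped ENNReal

/-! ### Husimi functions combine by scaled convolution -/

/-- Resolution of the identity on the second output mode. -/
theorem lintegral_husimi_mul_husimi {η : ℝ} (h0 : 0 ≤ η) (h1 : η ≤ 1) {ρX ρY : Matrix ℕ ℕ ℂ}
    (hX : IsDensity ρX) (hY : IsDensity ρY) (r : ℂ) :
    ∫⁻ s, ENNReal.ofReal (husimi ρX (((√η : ℝ) : ℂ) * r - ((√(1 - η) : ℝ) : ℂ) * s) *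
      husimi ρY (((√(1 - η) : ℝ) : ℂ) * r + ((√η : ℝ) : ℂ) * s)) =
      ENNReal.ofReal (husimi (output η ρX ρY) r) := by
  have hT := hX.jointOutput h0 h1 hY
  have hZ := hX.output h0 h1 hY
  have hM := fun s => summable_and_tsum_contract_husimiTerm hT r s
  have hsum : ∀ s, ∑' a, husimiTerm (contract (jointOutput η ρX ρY) r) s a =
      ((Real.pi ^ 2 * (husimi ρX (((√η : ℝ) : ℂ) * r - ((√(1 - η) : ℝ) : ℂ) * s) *
        husimi ρY (((√(1 - η) : ℝ) : ℂ) * r + ((√η : ℝ) : ℂ) * s)) : ℝ) : ℂ) := fun s => by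
    rw [(hM s).2, tsum_quadTerm_jointOutput h0 h1 hX hY, (hX.hasSum_husimiTerm _).tsum_eq,
      (hY.hasSum_husimiTerm _).tsum_eq]
    push_cast
    ring
  have hn : ∀ s, 0 ≤ ∑' a, husimiTerm (contract (jointOutput η ρX ρY) r) s a := fun s => by
    rw [hsum]
    exact Complex.zero_le_real.2 (mul_nonneg (by positivity)
      (mul_nonneg (hX.husimi_nonneg _) (hY.husimi_nonneg _)))
  -- Integrating over the second coherent amplitude gives the trace of the contracted matrix, which
  -- is the expectation of the reduced state in `|r⟩`. A common factor `π` remains on both sides.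
  have key := lintegral_husimi (fun s => (hM s).1) hn (hT.contract_diag_nonneg r)
  have hd := Complex.hasSum_re (hT.hasSum_contract_diag r)
  have hdn : ∀ k, 0 ≤ (contract (jointOutput η ρX ρY) r k k).re := fun k =>
    (Complex.nonneg_iff.1 (hT.contract_diag_nonneg r k)).1
  have hval : ∀ s, husimi (contract (jointOutput η ρX ρY) r) s =
      Real.pi * (husimi ρX (((√η : ℝ) : ℂ) * r - ((√(1 - η) : ℝ) : ℂ) * s) *
        husimi ρY (((√(1 - η) : ℝ) : ℂ) * r + ((√η : ℝ) : ℂ) * s)) := fun s => by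
    rw [husimi, hsum, Complex.ofReal_re]
    have := Real.pi_ne_zero
    field_simp
  rw [← ENNReal.ofReal_tsum_of_nonneg hdn hd.summable, hd.tsum_eq] at key
  have hout : (∑' a, husimiTerm (partialTrace (jointOutput η ρX ρY)) r a).re =
      Real.pi * husimi (output η ρX ρY) r := by
    have := (hZ.hasSum_husimiTerm r).tsum_eq
    rw [output] at this ⊢
    rw [this, Complex.ofReal_re]
  rw [hout] at key
  simp_rw [hval, ENNReal.ofReal_mul Real.pi_nonneg] at key
  rw [lintegral_const_mul' _ _ ENNReal.ofReal_ne_top] at key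
  exact (ENNReal.mul_right_inj (by simpa using Real.pi_pos) ENNReal.ofReal_ne_top).1 key

/-- The substitution `t = η r - √(η (1 - η)) s` is the one for which `t / √η` and `(r - t) / √(1 -
η)` are the rotated amplitudes. -/
theorem scaleDensity_mul_scaleDensity {η : ℝ} (h0 : 0 < η) (h1 : η < 1) (f g : ℂ → ℝ) (r s : ℂ) :
    scaleDensity η f (((η : ℝ) : ℂ) * r - √(η * (1 - η)) • s) *
      scaleDensity (1 - η) g (r - (((η : ℝ) : ℂ) * r - √(η * (1 - η)) • s)) =
      (1 / (η * (1 - η))) * (f (((√η : ℝ) : ℂ) * r - ((√(1 - η) : ℝ) : ℂ) * s) *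
        g (((√(1 - η) : ℝ) : ℂ) * r + ((√η : ℝ) : ℂ) * s)) := by
  have hη : 0 < 1 - η := by linarith
  have e1 := ofReal_sqrt_mul_self h0.le
  have e2 := ofReal_sqrt_mul_self hη.le
  have n1 : ((√η : ℝ) : ℂ) ≠ 0 := Complex.ofReal_ne_zero.2 (Real.sqrt_pos.2 h0).ne'
  have n2 : ((√(1 - η) : ℝ) : ℂ) ≠ 0 := Complex.ofReal_ne_zero.2 (Real.sqrt_pos.2 hη).ne'
  have hs : √(η * (1 - η)) • s = ((√η : ℝ) : ℂ) * ((√(1 - η) : ℝ) : ℂ) * s := by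
    rw [Complex.real_smul, Real.sqrt_mul h0.le, Complex.ofReal_mul]
  have a1 : (((η : ℝ) : ℂ) * r - √(η * (1 - η)) • s) / ((√η : ℝ) : ℂ) =
      ((√η : ℝ) : ℂ) * r - ((√(1 - η) : ℝ) : ℂ) * s := by
    rw [hs, div_eq_iff n1]
    linear_combination -r * e1
  have a2 : (r - (((η : ℝ) : ℂ) * r - √(η * (1 - η)) • s)) / ((√(1 - η) : ℝ) : ℂ) =
      ((√(1 - η) : ℝ) : ℂ) * r + ((√η : ℝ) : ℂ) * s := by
    rw [hs, div_eq_iff n2]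
    push_cast at e2
    linear_combination -r * e2
  rw [scaleDensity, scaleDensity, a1, a2]
  field_simp

theorem integrable_and_integral_husimi_mul {η : ℝ} (h0 : 0 ≤ η) (h1 : η ≤ 1)
    {ρX ρY : Matrix ℕ ℕ ℂ} (hX : IsDensity ρX) (hY : IsDensity ρY) (r : ℂ) :
    Integrable (fun s => husimi ρX (((√η : ℝ) : ℂ) * r - ((√(1 - η) : ℝ) : ℂ) * s) *
      husimi ρY (((√(1 - η) : ℝ) : ℂ) * r + ((√η : ℝ) : ℂ) * s)) ∧
    ∫ s, husimi ρX (((√η : ℝ) : ℂ) * r - ((√(1 - η) : ℝ) : ℂ) * s) *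
      husimi ρY (((√(1 - η) : ℝ) : ℂ) * r + ((√η : ℝ) : ℂ) * s) = husimi (output η ρX ρY) r := by
  have h := lintegral_husimi_mul_husimi h0 h1 hX hY r
  have hm : Measurable fun s => husimi ρX (((√η : ℝ) : ℂ) * r - ((√(1 - η) : ℝ) : ℂ) * s) *
      husimi ρY (((√(1 - η) : ℝ) : ℂ) * r + ((√η : ℝ) : ℂ) * s) :=
    (hX.measurable_husimi.comp (by fun_prop)).mul (hY.measurable_husimi.comp (by fun_prop))
  have hn := fun s => mul_nonneg
    (hX.husimi_nonneg (((√η : ℝ) : ℂ) * r - ((√(1 - η) : ℝ) : ℂ) * s))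
    (hY.husimi_nonneg (((√(1 - η) : ℝ) : ℂ) * r + ((√η : ℝ) : ℂ) * s))
  constructor
  · refine (lintegral_ofReal_ne_top_iff_integrable hm.aestronglyMeasurable
      (Filter.Eventually.of_forall hn)).1 ?_
    rw [h]
    exact ENNReal.ofReal_ne_top
  · rw [integral_eq_lintegral_of_nonneg_ae (Filter.Eventually.of_forall hn)
      hm.aestronglyMeasurable, h,
      ENNReal.toReal_ofReal ((hX.output h0 h1 hY).husimi_nonneg r)]

theorem sqrt_mul_one_sub_ne_zero {η : ℝ} (h0 : 0 < η) (h1 : η < 1) : √(η * (1 - η)) ≠ 0 := by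
  have hη : 0 < 1 - η := by linarith
  positivity

theorem convolutionExists_husimi {η : ℝ} (h0 : 0 < η) (h1 : η < 1) {ρX ρY : Matrix ℕ ℕ ℂ}
    (hX : IsDensity ρX) (hY : IsDensity ρY) :
    ConvolutionExists (scaleDensity η (husimi ρX)) (scaleDensity (1 - η) (husimi ρY))
      (ContinuousLinearMap.mul ℝ ℝ) volume := by
  intro r
  rw [ConvolutionExistsAt,
    ← integrable_comp_sub_left _ (((η : ℝ) : ℂ) * r),
    ← integrable_comp_smul_iff volume _ (sqrt_mul_one_sub_ne_zero h0 h1)]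
  simp only [ContinuousLinearMap.mul_apply', scaleDensity_mul_scaleDensity h0 h1]
  exact (integrable_and_integral_husimi_mul h0.le h1.le hX hY r).1.const_mul _

theorem husimi_output {η : ℝ} (h0 : 0 < η) (h1 : η < 1) {ρX ρY : Matrix ℕ ℕ ℂ}
    (hX : IsDensity ρX) (hY : IsDensity ρY) :
    husimi (output η ρX ρY) = scaleDensity η (husimi ρX) ⋆[ContinuousLinearMap.mul ℝ ℝ, volume]
      scaleDensity (1 - η) (husimi ρY) := by
  funext r
  have hη : 0 < 1 - η := by linarith
  -- The plane has real dimension two, so the Jacobian is `η (1 - η)`, which cancels the prefactors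
  -- of the two scaled densities.
  have e := Measure.integral_comp_smul (volume : Measure ℂ) (fun t =>
    scaleDensity η (husimi ρX) (((η : ℝ) : ℂ) * r - t) *
      scaleDensity (1 - η) (husimi ρY) (r - (((η : ℝ) : ℂ) * r - t))) √(η * (1 - η))
  rw [Complex.finrank_real_complex, Real.sq_sqrt (by positivity), abs_of_pos (by positivity),
    integral_sub_left_eq_self (fun t => scaleDensity η (husimi ρX) t *
      scaleDensity (1 - η) (husimi ρY) (r - t)) volume (((η : ℝ) : ℂ) * r)] at e
  simp only [scaleDensity_mul_scaleDensity h0 h1] at e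
  rw [integral_const_mul, (integrable_and_integral_husimi_mul h0.le h1.le hX hY r).2, one_div,
    smul_eq_mul] at e
  have := mul_left_cancel₀ (by positivity) e
  rw [convolution_def, this]
  rfl

/-! ### Laws of scaled sums -/

theorem map_lawOf_scale {t : ℝ} (ht : 0 < t) {f : ℂ → ℝ} (hf : Measurable f) :
    (lawOf f).map (fun r => ((√t : ℝ) : ℂ) * r) = lawOf (scaleDensity t f) := by
  have hs : √t ≠ 0 := (Real.sqrt_pos.2 ht).ne'
  have hc : ((√t : ℝ) : ℂ) ≠ 0 := Complex.ofReal_ne_zero.2 hs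
  have hm : Measurable fun r : ℂ => ((√t : ℝ) : ℂ) * r := by fun_prop
  have hg : Measurable fun r => ENNReal.ofReal (scaleDensity t f r) := by
    unfold scaleDensity
    exact ENNReal.measurable_ofReal.comp ((hf.comp (by fun_prop)).const_mul _)
  refine Measure.ext fun A hA => ?_
  rw [Measure.map_apply hm hA, lawOf, lawOf, withDensity_apply _ (hm hA), withDensity_apply _ hA,
    ← lintegral_indicator (hm hA), ← lintegral_indicator hA]
  have hmap := Measure.map_addHaar_smul (volume : Measure ℂ) hs
  have h2 := lintegral_map (μ := (volume : Measure ℂ)) (hg.indicator hA)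
    (measurable_const_smul √t)
  rw [hmap, Complex.finrank_real_complex, Real.sq_sqrt ht.le, abs_of_pos (by positivity),
    lintegral_smul_measure, smul_eq_mul] at h2
  have h3 : ∀ r : ℂ, (A.indicator fun r => ENNReal.ofReal (scaleDensity t f r)) (√t • r) =
      ENNReal.ofReal t⁻¹ * ((fun r : ℂ => ((√t : ℝ) : ℂ) * r) ⁻¹' A).indicator
        (fun r => ENNReal.ofReal (f r)) r := fun r => by
    rw [Complex.real_smul]
    by_cases hr : ((√t : ℝ) : ℂ) * r ∈ A
    · rw [Set.indicator_of_mem hr, Set.indicator_of_mem (Set.mem_preimage.2 hr), scaleDensity,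
        mul_div_cancel_left₀ _ hc, one_div, ENNReal.ofReal_mul (by positivity)]
    · rw [Set.indicator_of_notMem hr, Set.indicator_of_notMem (by exact hr), mul_zero]
  simp_rw [h3] at h2
  rw [lintegral_const_mul' _ _ ENNReal.ofReal_ne_top] at h2
  exact ((ENNReal.mul_right_inj (by simpa using ht) ENNReal.ofReal_ne_top).1 h2).symm

theorem scaledAddLaw_eq_conv {η : ℝ} (h0 : 0 < η) (h1 : η < 1) {f g : ℂ → ℝ} (hf : Measurable f)
    (hg : Measurable g) [SFinite (lawOf f)] [SFinite (lawOf g)] :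
    scaledAddLaw η (lawOf f) (lawOf g) =
      (lawOf (scaleDensity η f)).conv (lawOf (scaleDensity (1 - η) g)) := by
  rw [← map_lawOf_scale h0 hf, ← map_lawOf_scale (by linarith) hg, Measure.conv,
    Measure.map_prod_map _ _ (by fun_prop) (by fun_prop),
    Measure.map_map (by fun_prop) (by fun_prop)]
  rfl

/-- Existence of the convolution at every point identifies the Bochner convolution with the extended
nonnegative one, which is the density of a convolution of measures. -/
theorem lawOf_eq_scaledAddLaw {η : ℝ} (h0 : 0 < η) (h1 : η < 1) {f g : ℂ → ℝ} (hf : Measurable f)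
    (hg : Measurable g) (hf0 : ∀ r, 0 ≤ f r) (hg0 : ∀ r, 0 ≤ g r)
    (hc : ConvolutionExists (scaleDensity η f) (scaleDensity (1 - η) g)
      (ContinuousLinearMap.mul ℝ ℝ) volume) :
    lawOf (scaleDensity η f ⋆[ContinuousLinearMap.mul ℝ ℝ, volume] scaleDensity (1 - η) g) =
      scaledAddLaw η (lawOf f) (lawOf g) := by
  have hη : 0 < 1 - η := by linarith
  have hsf : Measurable (scaleDensity η f) := by
    unfold scaleDensity
    exact (hf.comp (by fun_prop)).const_mul _
  have hsg : Measurable (scaleDensity (1 - η) g) := by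
    unfold scaleDensity
    exact (hg.comp (by fun_prop)).const_mul _
  have hpf : ∀ r, 0 ≤ scaleDensity η f r := fun r => mul_nonneg (by positivity) (hf0 _)
  have hpg : ∀ r, 0 ≤ scaleDensity (1 - η) g r := fun r => mul_nonneg (by positivity) (hg0 _)
  have : SFinite (lawOf f) := by unfold lawOf; infer_instance
  have : SFinite (lawOf g) := by unfold lawOf; infer_instance
  have hconv := conv_withDensity_eq_lconvolution (μ := (volume : Measure ℂ))
    (f := fun r => ENNReal.ofReal (scaleDensity η f r))
    (g := fun r => ENNReal.ofReal (scaleDensity (1 - η) g r))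
    (ENNReal.measurable_ofReal.comp hsf) (ENNReal.measurable_ofReal.comp hsg)
  rw [scaledAddLaw_eq_conv h0 h1 hf hg, lawOf, lawOf, lawOf, hconv]
  congr 1
  funext r
  rw [convolution_def, lconvolution_def, ofReal_integral_eq_lintegral_ofReal (hc r)
    (Filter.Eventually.of_forall fun t => mul_nonneg (hpf _) (hpg _))]
  refine lintegral_congr fun t => ?_
  rw [ContinuousLinearMap.mul_apply', ENNReal.ofReal_mul (hpf t), neg_add_eq_sub]

end NumberMixing

/-! ### Laguerre polynomials and characteristic functions of number states. -/

namespace NumberMixing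

open Finset.HasAntidiagonal (antidiagonal mem_antidiagonal)

/-! ### Binomial identities -/

theorem sum_antidiagonal_choose_mul_choose (n k : ℕ) :
    ∑ a ∈ antidiagonal k, (k.choose a.1) * n.choose a.1 = (n + k).choose k := by
  rw [Nat.add_choose_eq]
  refine Finset.sum_congr rfl fun a ha => ?_
  rw [mem_antidiagonal] at ha
  rw [Nat.choose_symm_of_eq_add ha.symm, mul_comm]

theorem sum_range_choose_mul_choose (k l N : ℕ) (h : l ≤ N) :
    ∑ i ∈ Finset.range (N + 1), k.choose i * l.choose i = (k + l).choose l := by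
  rw [← sum_antidiagonal_choose_mul_choose, Finset.Nat.sum_antidiagonal_eq_sum_range_succ_mk]
  have hsub : Finset.range l.succ ⊆ Finset.range (N + 1) := Finset.range_mono (by omega)
  rw [← Finset.sum_subset hsub fun i _ hi => ?_]
  · exact Finset.sum_congr rfl fun i _ => mul_comm _ _
  · rw [Nat.choose_eq_zero_of_lt (show l < i by simpa using hi), mul_zero]

/-- Up to sign, this is the `n`-th forward difference at zero of the binomial polynomial of degree
`i`. -/
theorem sum_range_alternating_choose_mul_choose (n i : ℕ) :
    ∑ k ∈ Finset.range (n + 1), (-1 : ℝ) ^ k * n.choose k * k.choose i =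
      if n = i then (-1) ^ n else 0 := by
  have h := fwdDiff_iter_choose_zero i n
  rw [fwdDiff_iter_eq_sum_shift] at h
  have h2 := congrArg (fun z : ℤ => (-1 : ℝ) ^ n * (z : ℝ)) h
  simp only [zero_add, smul_eq_mul, mul_one, Int.cast_sum, Int.cast_mul, Int.cast_pow,
    Int.cast_neg, Int.cast_one, Int.cast_natCast, Finset.mul_sum] at h2
  rw [Finset.sum_congr rfl fun k hk => ?_, h2]
  · split_ifs <;> simp
  · have hk' : k ≤ n := by simpa [Nat.lt_succ_iff] using hk
    have e : (-1 : ℝ) ^ n * (-1) ^ (n - k) = (-1) ^ k := by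
      obtain ⟨d, rfl⟩ := Nat.exists_eq_add_of_le hk'
      rw [Nat.add_sub_cancel_left, pow_add, mul_assoc, ← mul_pow]
      simp
    rw [← mul_assoc, ← mul_assoc, e]

/-! ### Laguerre polynomials -/

/-- Kummer's identity for Laguerre polynomials. -/
theorem tsum_choose_mul_pow_div_factorial (n : ℕ) (x : ℝ) :
    ∑' k : ℕ, ((n + k).choose k : ℝ) * ((-x) ^ k / (k ! : ℝ)) = Real.exp (-x) * laguerre n x := by
  have h1 : laguerre n x = ∑' k : ℕ, (-1) ^ k * (n.choose k : ℝ) * x ^ k / (k ! : ℝ) := by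
    rw [laguerre, tsum_eq_sum]
    intro k hk
    rw [Nat.choose_eq_zero_of_lt (by simpa using hk)]
    simp
  have h2 : Real.exp (-x) = ∑' k : ℕ, (-x) ^ k / (k ! : ℝ) := by
    rw [Real.exp_eq_exp_ℝ, (NormedSpace.expSeries_div_hasSum_exp (-x)).tsum_eq]
  -- Cauchy product of the polynomial with the exponential series; Vandermonde's identity evaluates
  -- the coefficients.
  rw [mul_comm, h1, h2, tsum_mul_tsum_eq_tsum_sum_antidiagonal_of_summable_norm]
  · refine tsum_congr fun k => ?_
    rw [← sum_antidiagonal_choose_mul_choose, Nat.cast_sum, Finset.sum_mul]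
    refine Finset.sum_congr rfl fun a ha => ?_
    rw [mem_antidiagonal] at ha
    have hf : (k.choose a.1 : ℝ) * (a.1 ! : ℝ) * (a.2 ! : ℝ) = (k ! : ℝ) := by
      rw [← ha, Nat.choose_symm_add]
      exact_mod_cast Nat.add_choose_mul_factorial_mul_factorial a.1 a.2
    have hp : (-x) ^ k = (-1) ^ a.1 * x ^ a.1 * (-x) ^ a.2 := by
      rw [← ha, pow_add, neg_pow x a.1]
    rw [hp, ← hf]
    have n1 : (a.1 ! : ℝ) ≠ 0 := by positivity
    have n2 : (a.2 ! : ℝ) ≠ 0 := by positivity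
    have n3 : (k.choose a.1 : ℝ) ≠ 0 := by
      exact_mod_cast (Nat.choose_pos (by omega)).ne'
    push_cast
    field_simp
  · refine summable_of_ne_finset_zero (s := Finset.range (n + 1)) fun k hk => ?_
    rw [Nat.choose_eq_zero_of_lt (by simpa using hk)]
    simp
  · exact (Real.summable_pow_div_factorial (-x)).norm

theorem exp_mul_laguerre_mul_laguerre (m n : ℕ) (s : ℂ) :
    Real.exp (-‖s‖ ^ 2) * (laguerre m (‖s‖ ^ 2) * laguerre n (‖s‖ ^ 2)) =
      ∑ k ∈ Finset.range (m + 1), ∑ l ∈ Finset.range (n + 1),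
        (-1) ^ k * (m.choose k : ℝ) / (k ! : ℝ) * ((-1) ^ l * (n.choose l : ℝ) / (l ! : ℝ)) *
          (Real.exp (-‖s‖ ^ 2) * ‖s‖ ^ (2 * (k + l))) := by
  rw [laguerre, laguerre, Finset.sum_mul_sum, Finset.mul_sum]
  refine Finset.sum_congr rfl fun k _ => ?_
  rw [Finset.mul_sum]
  refine Finset.sum_congr rfl fun l _ => ?_
  rw [mul_add, pow_add, pow_mul, pow_mul]
  ring

theorem integrable_exp_mul_laguerre_mul_laguerre (m n : ℕ) : Integrable fun s : ℂ =>
    Real.exp (-‖s‖ ^ 2) * (laguerre m (‖s‖ ^ 2) * laguerre n (‖s‖ ^ 2)) := by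
  simp_rw [exp_mul_laguerre_mul_laguerre]
  exact integrable_finsetSum _ fun k _ => integrable_finsetSum _ fun l _ =>
    (integrable_norm_pow_mul_exp _).const_mul _

/-- Orthogonality of the Laguerre polynomials, in the plane. -/
theorem integral_exp_mul_laguerre_mul_laguerre (m n : ℕ) :
    ∫ s : ℂ, Real.exp (-‖s‖ ^ 2) * (laguerre m (‖s‖ ^ 2) * laguerre n (‖s‖ ^ 2)) =
      if m = n then Real.pi else 0 := by
  simp_rw [exp_mul_laguerre_mul_laguerre]
  rw [integral_finsetSum _ fun k _ => integrable_finsetSum _ fun l _ =>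
    (integrable_norm_pow_mul_exp _).const_mul _]
  simp_rw [integral_finsetSum _ fun l _ => (integrable_norm_pow_mul_exp _).const_mul _,
    integral_const_mul, integral_norm_pow_mul_exp]
  -- The Gaussian moment contributes `(k + l)! / (k! l!)`, a binomial coefficient that Vandermonde's
  -- identity expands over `i`. This separates `k` from `l`, and each alternating sum becomes a
  -- Kronecker delta.
  have h : ∀ k ∈ Finset.range (m + 1), ∀ l ∈ Finset.range (n + 1),
      (-1 : ℝ) ^ k * (m.choose k : ℝ) / (k ! : ℝ) * ((-1) ^ l * (n.choose l : ℝ) / (l ! : ℝ)) *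
          (Real.pi * ((k + l)! : ℝ)) = Real.pi * ∑ i ∈ Finset.range (n + 1),
        ((-1) ^ k * (m.choose k : ℝ) * (k.choose i : ℝ)) *
          ((-1) ^ l * (n.choose l : ℝ) * (l.choose i : ℝ)) := by
    intro k _ l hl
    have hf : ((k + l)! : ℝ) = ((k + l).choose l : ℝ) * (k ! : ℝ) * (l ! : ℝ) := by
      have := Nat.add_choose_mul_factorial_mul_factorial k l
      exact_mod_cast this.symm
    have hv := sum_range_choose_mul_choose k l n (by simpa [Nat.lt_succ_iff] using hl)
    have e : ∑ i ∈ Finset.range (n + 1), ((-1 : ℝ) ^ k * (m.choose k : ℝ) * (k.choose i : ℝ)) *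
        ((-1) ^ l * (n.choose l : ℝ) * (l.choose i : ℝ)) =
        (-1) ^ k * (m.choose k : ℝ) * ((-1) ^ l * (n.choose l : ℝ)) * ((k + l).choose l : ℝ) := by
      rw [← hv, Nat.cast_sum, Finset.mul_sum]
      refine Finset.sum_congr rfl fun i _ => ?_
      push_cast
      ring
    rw [e, hf]
    have n1 : (k ! : ℝ) ≠ 0 := by positivity
    have n2 : (l ! : ℝ) ≠ 0 := by positivity
    field_simp
  rw [Finset.sum_congr rfl fun k hk => Finset.sum_congr rfl fun l hl => h k hk l hl]
  simp_rw [← Finset.mul_sum]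
  rw [Finset.sum_congr rfl fun k _ => Finset.sum_comm, Finset.sum_comm]
  simp_rw [← Finset.sum_mul_sum, sum_range_alternating_choose_mul_choose]
  rw [Finset.sum_eq_single n]
  · rw [if_pos rfl]
    split_ifs with hmn
    · rw [hmn, ← mul_pow]
      simp
    · simp
  · intro i _ hi
    rw [if_neg hi.symm, mul_zero]
  · intro hn
    simp at hn

/-! ### Characteristic functions of number states -/

/-- The Husimi function of the number state `|n⟩`, without the factor `1 / π`. -/
noncomputable def numberHusimi (n : ℕ) (r : ℂ) : ℝ :=
  Real.exp (-‖r‖ ^ 2) * ‖r‖ ^ (2 * n) / (n ! : ℝ)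

theorem numberHusimi_nonneg (n : ℕ) (r : ℂ) : 0 ≤ numberHusimi n r := by
  unfold numberHusimi
  positivity

theorem continuous_numberHusimi (n : ℕ) : Continuous (numberHusimi n) := by
  unfold numberHusimi
  fun_prop

theorem integrable_numberHusimi (n : ℕ) : Integrable (numberHusimi n) :=
  (integrable_norm_pow_mul_exp n).div_const _

theorem integral_numberHusimi (n : ℕ) : ∫ r, numberHusimi n r = Real.pi := by
  unfold numberHusimi
  rw [integral_div, integral_norm_pow_mul_exp, mul_div_cancel_right₀ _ (by positivity)]

theorem integrable_numberHusimi_mul_exp (n : ℕ) (c : ℝ) :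
    Integrable fun r : ℂ => numberHusimi n r * Real.exp (2 * ‖r‖ * c) := by
  have hc : Continuous fun r : ℂ => numberHusimi n r * Real.exp (2 * ‖r‖ * c) :=
    (continuous_numberHusimi n).mul (by fun_prop)
  have h1 : Integrable fun r : ℂ => ‖r‖ ^ ((2 * n : ℕ) : ℝ) * Real.exp (-(1 / 2) * ‖r‖ ^ (2 : ℝ)) := by
    refine not_imp_comm.1 integral_undef ?_
    have hq : (0 : ℝ) ≤ ((2 * n : ℕ) : ℝ) := Nat.cast_nonneg _
    rw [Complex.integral_rpow_mul_exp_neg_mul_rpow (by norm_num) (by linarith) (by norm_num)]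
    have := Real.Gamma_pos_of_pos (show 0 < (((2 * n : ℕ) : ℝ) + 2) / 2 by positivity)
    positivity
  refine (h1.const_mul (Real.exp (2 * c ^ 2) / (n ! : ℝ))).mono' hc.aestronglyMeasurable
    (Filter.Eventually.of_forall fun r => ?_)
  rw [Real.norm_of_nonneg (mul_nonneg (numberHusimi_nonneg n r) (by positivity)),
    Real.rpow_natCast, Real.rpow_two, numberHusimi]
  -- Half of the Gaussian absorbs the linear exponent, by completing the square.
  have h2 : Real.exp (-‖r‖ ^ 2) * Real.exp (2 * ‖r‖ * c) ≤
      Real.exp (2 * c ^ 2) * Real.exp (-(1 / 2) * ‖r‖ ^ 2) := by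
    rw [← Real.exp_add, ← Real.exp_add, Real.exp_le_exp]
    nlinarith [sq_nonneg (‖r‖ - 2 * c)]
  calc _ = (Real.exp (-‖r‖ ^ 2) * Real.exp (2 * ‖r‖ * c)) * (‖r‖ ^ (2 * n) / (n ! : ℝ)) := by ring
    _ ≤ (Real.exp (2 * c ^ 2) * Real.exp (-(1 / 2) * ‖r‖ ^ 2)) * (‖r‖ ^ (2 * n) / (n ! : ℝ)) := by
      gcongr
    _ = _ := by ring

theorem integral_comp_rotate (f : ℂ → ℂ) (θ : ℝ) :
    ∫ r, f (Complex.exp (θ * Complex.I) * r) = ∫ r, f r := by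
  have h := (rotation (Circle.exp θ)).measurePreserving.integral_comp
    (rotation (Circle.exp θ)).toHomeomorph.measurableEmbedding f
  simpa [rotation_apply, Circle.coe_exp] using h

/-- Rotation by `π / (j - k)` preserves the integral and changes the sign of the integrand. -/
theorem integral_numberHusimi_mul_pow_of_ne (n : ℕ) {j k : ℕ} (hjk : j ≠ k) :
    ∫ r : ℂ, (numberHusimi n r : ℂ) * (r ^ j * conj r ^ k) = 0 := by
  have hz : ((j : ℂ) - k) ≠ 0 := sub_ne_zero.2 (by exact_mod_cast hjk)
  have h := integral_comp_rotate (fun r => (numberHusimi n r : ℂ) * (r ^ j * conj r ^ k))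
    (Real.pi / ((j : ℝ) - k))
  have e : ∀ r : ℂ, (numberHusimi n (Complex.exp ((Real.pi / ((j : ℝ) - k) : ℝ) * Complex.I) * r) : ℂ)
      * ((Complex.exp ((Real.pi / ((j : ℝ) - k) : ℝ) * Complex.I) * r) ^ j *
        conj (Complex.exp ((Real.pi / ((j : ℝ) - k) : ℝ) * Complex.I) * r) ^ k) =
      -((numberHusimi n r : ℂ) * (r ^ j * conj r ^ k)) := fun r => by
    have e1 : numberHusimi n (Complex.exp ((Real.pi / ((j : ℝ) - k) : ℝ) * Complex.I) * r) =
        numberHusimi n r := by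
      rw [numberHusimi, norm_mul, Complex.norm_exp_ofReal_mul_I, one_mul, numberHusimi]
    have e2 : Complex.exp ((Real.pi / ((j : ℝ) - k) : ℝ) * Complex.I) ^ j *
        conj (Complex.exp ((Real.pi / ((j : ℝ) - k) : ℝ) * Complex.I)) ^ k = -1 := by
      rw [← Complex.exp_conj, ← Complex.exp_nat_mul, ← Complex.exp_nat_mul, ← Complex.exp_add,
        ← Complex.exp_pi_mul_I]
      congr 1
      simp only [map_mul, Complex.conj_ofReal, Complex.conj_I]
      push_cast
      field_simp
      ring
    rw [e1, map_mul, mul_pow, mul_pow]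
    linear_combination (numberHusimi n r : ℂ) * (r ^ j * conj r ^ k) * e2
  simp_rw [e, integral_neg] at h
  exact self_eq_neg.1 h.symm

theorem integral_numberHusimi_mul_pow_self (n k : ℕ) :
    ∫ r : ℂ, (numberHusimi n r : ℂ) * (r ^ k * conj r ^ k) =
      ((Real.pi * ((n + k)! : ℝ) / (n ! : ℝ) : ℝ) : ℂ) := by
  rw [← integral_norm_pow_mul_exp, ← integral_div, ← integral_complex_ofReal]
  refine integral_congr_ae (Filter.Eventually.of_forall fun r => ?_)
  dsimp only
  rw [← mul_pow, Complex.mul_conj, Complex.normSq_eq_norm_sq, ← Complex.ofReal_pow,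
    ← Complex.ofReal_mul, numberHusimi, mul_add, pow_add, pow_mul _ 2 k]
  congr 1
  ring

/-- Expanding the two exponentials separately leaves only the equal powers of `r` and its conjugate;
their moments form the series in Kummer's identity. Domination uses
`integrable_numberHusimi_mul_exp`. -/
theorem charFn_numberHusimi (n : ℕ) (s : ℂ) : charFn (numberHusimi n) s =
    ((Real.pi * (Real.exp (-‖s‖ ^ 2) * laguerre n (‖s‖ ^ 2)) : ℝ) : ℂ) := by
  let F : ℕ × ℕ → ℂ → ℂ := fun a r => (numberHusimi n r : ℂ) *
    ((r * conj s) ^ a.1 / (a.1 ! : ℂ) * ((-(conj r * s)) ^ a.2 / (a.2 ! : ℂ)))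
  let bound : ℕ × ℕ → ℂ → ℝ := fun a r => numberHusimi n r *
    ((‖r‖ * ‖s‖) ^ a.1 / (a.1 ! : ℝ) * ((‖r‖ * ‖s‖) ^ a.2 / (a.2 ! : ℝ)))
  have hexp : ∀ t : ℝ, HasSum (fun k : ℕ => t ^ k / (k ! : ℝ)) (Real.exp t) := fun t => by
    rw [Real.exp_eq_exp_ℝ]
    exact NormedSpace.expSeries_div_hasSum_exp t
  have hcexp : ∀ t : ℂ, HasSum (fun k : ℕ => t ^ k / (k ! : ℂ)) (Complex.exp t) := fun t => by
    rw [Complex.exp_eq_exp_ℂ]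
    exact NormedSpace.expSeries_div_hasSum_exp t
  have hcn : ∀ t : ℂ, Summable fun k : ℕ => ‖t ^ k / (k ! : ℂ)‖ := fun t => by
    simp_rw [norm_div, norm_pow, Complex.norm_natCast]
    exact Real.summable_pow_div_factorial ‖t‖
  have hbound : ∀ r, HasSum (fun a => bound a r) (numberHusimi n r * Real.exp (2 * ‖r‖ * ‖s‖)) := by
    intro r
    have h := (hexp (‖r‖ * ‖s‖)).mul (hexp (‖r‖ * ‖s‖))
      ((hexp (‖r‖ * ‖s‖)).summable.mul_of_nonneg (hexp (‖r‖ * ‖s‖)).summable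
        (fun _ => by positivity) (fun _ => by positivity))
    rw [← Real.exp_add, show ‖r‖ * ‖s‖ + ‖r‖ * ‖s‖ = 2 * ‖r‖ * ‖s‖ by ring] at h
    exact h.mul_left _
  have hnorm : ∀ a r, ‖F a r‖ = bound a r := fun a r => by
    simp only [F, bound, norm_mul, norm_div, norm_pow, norm_neg, RCLike.norm_conj,
      Complex.norm_natCast, Complex.norm_real, Real.norm_of_nonneg (numberHusimi_nonneg n r)]
  have hF : ∀ r, HasSum (fun a => F a r)
      ((numberHusimi n r : ℂ) * Complex.exp (r * conj s - conj r * s)) := fun r => by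
    have h := (hcexp (r * conj s)).mul (hcexp (-(conj r * s)))
      (summable_mul_of_summable_norm (f := fun k : ℕ => (r * conj s) ^ k / (k ! : ℂ))
        (g := fun k : ℕ => (-(conj r * s)) ^ k / (k ! : ℂ)) (hcn _) (hcn _))
    rw [← Complex.exp_add, ← sub_eq_add_neg] at h
    exact h.mul_left _
  have hcont : ∀ a, Continuous (F a) := fun a => by
    have := continuous_numberHusimi n
    have := Complex.continuous_conj
    fun_prop
  have key := hasSum_integral_of_dominated_convergence (μ := (volume : Measure ℂ)) bound
    (fun a => (hcont a).aestronglyMeasurable)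
    (fun a => Filter.Eventually.of_forall fun r => (hnorm a r).le)
    (Filter.Eventually.of_forall fun r => (hbound r).summable)
    (by simp_rw [fun r => (hbound r).tsum_eq]; exact integrable_numberHusimi_mul_exp n ‖s‖)
    (Filter.Eventually.of_forall hF)
  have hval : ∀ a : ℕ × ℕ, ∫ r, F a r = conj s ^ a.1 * (-s) ^ a.2 / ((a.1 ! : ℂ) * (a.2 ! : ℂ)) *
      ∫ r : ℂ, (numberHusimi n r : ℂ) * (r ^ a.1 * conj r ^ a.2) := fun a => by
    rw [← integral_const_mul]
    refine integral_congr_ae (Filter.Eventually.of_forall fun r => ?_)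
    simp only [F]
    rw [mul_pow, show -(conj r * s) = conj r * (-s) by ring, mul_pow]
    have n1 : (a.1 ! : ℂ) ≠ 0 := by exact_mod_cast Nat.factorial_ne_zero _
    have n2 : (a.2 ! : ℂ) ≠ 0 := by exact_mod_cast Nat.factorial_ne_zero _
    field_simp
  have hinj : Function.Injective fun j : ℕ => (j, j) := fun i j h => (Prod.mk.inj h).1
  rw [charFn, ← key.tsum_eq, ← hinj.tsum_eq, ← tsum_choose_mul_pow_div_factorial, ← tsum_mul_left,
    Complex.ofReal_tsum]
  · refine tsum_congr fun k => ?_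
    rw [hval, integral_numberHusimi_mul_pow_self]
    have hs : conj s ^ k * (-s) ^ k = (((-‖s‖ ^ 2) ^ k : ℝ) : ℂ) := by
      rw [← mul_pow, mul_neg, mul_comm, Complex.mul_conj, Complex.normSq_eq_norm_sq]
      push_cast
      ring
    have hf : ((n + k)! : ℝ) = ((n + k).choose k : ℝ) * (n ! : ℝ) * (k ! : ℝ) := by
      have := Nat.add_choose_mul_factorial_mul_factorial n k
      exact_mod_cast this.symm
    rw [hs, hf]
    have n1 : (n ! : ℂ) ≠ 0 := by exact_mod_cast Nat.factorial_ne_zero _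
    have n2 : (k ! : ℂ) ≠ 0 := by exact_mod_cast Nat.factorial_ne_zero _
    push_cast
    field_simp
  · rintro ⟨i, j⟩ hx
    by_contra h'
    have hij : i ≠ j := by
      rintro rfl
      exact h' ⟨i, rfl⟩
    exact hx ((hval (i, j)).trans (by rw [integral_numberHusimi_mul_pow_of_ne n hij, mul_zero]))

theorem norm_exp_mul_conj_sub (r s : ℂ) : ‖Complex.exp (r * conj s - conj r * s)‖ = 1 := by
  have h : (r * conj s - conj r * s).re = 0 := by
    simp only [Complex.sub_re, Complex.mul_re, Complex.conj_re, Complex.conj_im]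
    ring
  rw [Complex.norm_exp, h, Real.exp_zero]

/-- Up to the factor `π` this is a characteristic function, hence bounded by the total mass. The
uniformity in `n` is what allows summation against a p.m.f. -/
theorem abs_exp_mul_laguerre_le_one (n : ℕ) (s : ℂ) :
    |Real.exp (-‖s‖ ^ 2) * laguerre n (‖s‖ ^ 2)| ≤ 1 := by
  have h : ‖charFn (numberHusimi n) s‖ ≤ Real.pi := by
    rw [charFn, ← integral_numberHusimi n]
    refine (norm_integral_le_integral_norm _).trans (le_of_eq ?_)
    refine integral_congr_ae (Filter.Eventually.of_forall fun r => ?_)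
    simp only [norm_mul, norm_exp_mul_conj_sub, mul_one, Complex.norm_real,
      Real.norm_of_nonneg (numberHusimi_nonneg n r)]
  rw [charFn_numberHusimi, Complex.norm_real, Real.norm_eq_abs, abs_mul,
    abs_of_pos Real.pi_pos] at h
  exact le_of_mul_le_mul_left (by rwa [mul_one]) Real.pi_pos

end NumberMixing

/-! ### Inversion of the transform and number-diagonal inputs. -/

namespace NumberMixing

/-! ### The transform and its inverse -/

theorem hasSum_toReal_pmf (p : PMF ℕ) : HasSum (fun n => (p n).toReal) 1 := by
  have h := ENNReal.hasSum_toReal (p.tsum_coe.trans_ne ENNReal.one_ne_top)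
  rwa [← ENNReal.tsum_toReal_eq fun n => p.apply_ne_top n, p.tsum_coe, ENNReal.toReal_one] at h

theorem charFn_transform (p : PMF ℕ) (s : ℂ) : charFn (transform p) s =
    ((∑' n, (p n).toReal * (Real.exp (-‖s‖ ^ 2) * laguerre n (‖s‖ ^ 2)) : ℝ) : ℂ) := by
  have hp := hasSum_toReal_pmf p
  have hpi := Real.pi_pos
  let F : ℕ → ℂ → ℂ := fun n r => (((1 / Real.pi) * (p n).toReal : ℝ) : ℂ) *
    ((numberHusimi n r : ℂ) * Complex.exp (r * conj s - conj r * s))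
  have hc : ∀ n, Continuous (F n) := fun n => by
    have := continuous_numberHusimi n
    have := Complex.continuous_conj
    fun_prop
  have hn : ∀ n r, ‖F n r‖ = ((1 / Real.pi) * (p n).toReal) * numberHusimi n r := fun n r => by
    simp only [F]
    rw [norm_mul, norm_mul, norm_exp_mul_conj_sub, mul_one, Complex.norm_real, Complex.norm_real,
      Real.norm_of_nonneg (numberHusimi_nonneg n r),
      Real.norm_of_nonneg (mul_nonneg (by positivity) ENNReal.toReal_nonneg)]
  have hint : ∀ n, Integrable (F n) := fun n =>
    ((integrable_numberHusimi n).const_mul ((1 / Real.pi) * (p n).toReal)).mono'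
      (hc n).aestronglyMeasurable (Filter.Eventually.of_forall fun r => (hn n r).le)
  have key := hasSum_integral_of_summable_integral_norm hint (by
    simp_rw [hn, integral_const_mul, integral_numberHusimi]
    exact (hp.summable.mul_left (1 / Real.pi)).mul_right Real.pi)
  have hval : ∀ n, ∫ r, F n r =
      (((p n).toReal * (Real.exp (-‖s‖ ^ 2) * laguerre n (‖s‖ ^ 2)) : ℝ) : ℂ) := fun n => by
    have h1 := charFn_numberHusimi n s
    rw [charFn] at h1
    simp only [F]
    rw [integral_const_mul, h1, ← Complex.ofReal_mul]
    congr 1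
    field_simp
  rw [Complex.ofReal_tsum, ← tsum_congr hval, key.tsum_eq, charFn]
  refine integral_congr_ae (Filter.Eventually.of_forall fun r => ?_)
  simp only [F, transform, Complex.ofReal_mul, Complex.ofReal_tsum]
  rw [← tsum_mul_left, ← tsum_mul_right]
  refine tsum_congr fun n => ?_
  rw [numberHusimi]
  push_cast
  ring

theorem invIntegrand_transform (p : PMF ℕ) (m : ℕ) (s : ℂ) : invIntegrand (transform p) m s =
    ((∑' n, (p n).toReal * (Real.exp (-‖s‖ ^ 2) *
      (laguerre m (‖s‖ ^ 2) * laguerre n (‖s‖ ^ 2))) : ℝ) : ℂ) := by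
  rw [invIntegrand, charFn_transform, ← Complex.ofReal_mul, ← tsum_mul_left]
  congr 1
  refine tsum_congr fun n => ?_
  ring

theorem integrable_tsum_of_summable_integral_norm {α : Type*} [MeasurableSpace α] {μ : Measure α}
    {F : ℕ → α → ℝ} (hF : ∀ n, Integrable (F n) μ) (hp : ∀ s, Summable fun n => F n s)
    (hs : Summable fun n => ∫ a, ‖F n a‖ ∂μ) : Integrable (fun s => ∑' n, F n s) μ := by
  refine ⟨aestronglyMeasurable_of_tendsto_ae Filter.atTop
    (f := fun N s => ∑ n ∈ Finset.range N, F n s)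
    (fun N => (integrable_finsetSum _ fun n _ => hF n).aestronglyMeasurable)
    (Filter.Eventually.of_forall fun s => (hp s).hasSum.tendsto_sum_nat), ?_⟩
  rw [hasFiniteIntegral_iff_enorm]
  calc ∫⁻ s, ‖∑' n, F n s‖ₑ ∂μ ≤ ∫⁻ s, ∑' n, ‖F n s‖ₑ ∂μ :=
        lintegral_mono fun s => enorm_tsum_le_tsum_enorm
    _ = ∑' n, ENNReal.ofReal (∫ s, ‖F n s‖ ∂μ) := by
        rw [lintegral_tsum fun n => (hF n).aestronglyMeasurable.enorm]
        exact tsum_congr fun n => (ofReal_integral_norm_eq_lintegral_enorm (hF n)).symm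
    _ < ⊤ := by
        rw [← ENNReal.ofReal_tsum_of_nonneg (fun n => integral_nonneg fun _ => norm_nonneg _) hs]
        exact ENNReal.ofReal_lt_top

/-- `𝒯⁻¹` inverts `𝒯`, with absolutely convergent integrals. -/
theorem invTransform_transform (p : PMF ℕ) (m : ℕ) :
    Integrable (invIntegrand (transform p) m) ∧
      invTransform (transform p) m = (((p m).toReal : ℝ) : ℂ) := by
  have hp := hasSum_toReal_pmf p
  let G : ℕ → ℂ → ℝ := fun n s => (p n).toReal * (Real.exp (-‖s‖ ^ 2) *
    (laguerre m (‖s‖ ^ 2) * laguerre n (‖s‖ ^ 2)))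
  have hG : ∀ n, Integrable (G n) := fun n =>
    (integrable_exp_mul_laguerre_mul_laguerre m n).const_mul _
  have hpt : ∀ s, Summable fun n => G n s := fun s => by
    refine Summable.of_norm_bounded (hp.summable.mul_right |laguerre m (‖s‖ ^ 2)|) fun n => ?_
    have h1 := abs_exp_mul_laguerre_le_one n s
    have e : G n s = (p n).toReal * (laguerre m (‖s‖ ^ 2) *
        (Real.exp (-‖s‖ ^ 2) * laguerre n (‖s‖ ^ 2))) := by simp only [G]; ring
    rw [e, norm_mul, norm_mul, Real.norm_of_nonneg ENNReal.toReal_nonneg, Real.norm_eq_abs,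
      Real.norm_eq_abs]
    exact mul_le_mul_of_nonneg_left (mul_le_of_le_one_right (abs_nonneg _) h1)
      ENNReal.toReal_nonneg
  -- An `L¹` bound uniform in `n`: the product is at most the mean of the two squares, each of
  -- weighted integral `π`. It justifies exchanging the sum with the outer integral.
  have hL : ∀ n, ∫ s : ℂ, |Real.exp (-‖s‖ ^ 2) *
      (laguerre m (‖s‖ ^ 2) * laguerre n (‖s‖ ^ 2))| ≤ Real.pi := fun n => by
    have hm := integrable_exp_mul_laguerre_mul_laguerre m m
    have hn := integrable_exp_mul_laguerre_mul_laguerre n n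
    have h1 := integral_mono (integrable_exp_mul_laguerre_mul_laguerre m n).norm
      ((hm.add hn).div_const 2) fun s => by
        have h3 := Real.exp_pos (-‖s‖ ^ 2)
        have h4 : |laguerre m (‖s‖ ^ 2) * laguerre n (‖s‖ ^ 2)| ≤
            (laguerre m (‖s‖ ^ 2) * laguerre m (‖s‖ ^ 2) +
              laguerre n (‖s‖ ^ 2) * laguerre n (‖s‖ ^ 2)) / 2 := by
          rw [abs_le]
          constructor
          · nlinarith [sq_nonneg (laguerre m (‖s‖ ^ 2) + laguerre n (‖s‖ ^ 2))]
          · nlinarith [sq_nonneg (laguerre m (‖s‖ ^ 2) - laguerre n (‖s‖ ^ 2))]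
        simp only [Pi.add_apply]
        rw [Real.norm_eq_abs, abs_mul, abs_of_pos h3, ← mul_add, mul_div_assoc]
        exact mul_le_mul_of_nonneg_left h4 h3.le
    simp only [Pi.add_apply] at h1
    rw [integral_div, integral_add hm hn, integral_exp_mul_laguerre_mul_laguerre,
      integral_exp_mul_laguerre_mul_laguerre, if_pos rfl, if_pos rfl, add_self_div_two] at h1
    exact h1
  have hs : Summable fun n => ∫ s, ‖G n s‖ := by
    refine Summable.of_nonneg_of_le (fun n => integral_nonneg fun _ => norm_nonneg _)
      (fun n => ?_) (hp.summable.mul_right Real.pi)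
    simp only [G, norm_mul (p n).toReal, Real.norm_of_nonneg (ENNReal.toReal_nonneg (a := p n))]
    rw [integral_const_mul]
    exact mul_le_mul_of_nonneg_left (hL n) ENNReal.toReal_nonneg
  have hfun : invIntegrand (transform p) m = fun s => ((∑' n, G n s : ℝ) : ℂ) :=
    funext (invIntegrand_transform p m)
  refine ⟨hfun ▸ (integrable_tsum_of_summable_integral_norm hG hpt hs).ofReal, ?_⟩
  rw [invTransform, hfun, integral_complex_ofReal,
    ← (hasSum_integral_of_summable_integral_norm hG hs).tsum_eq, tsum_eq_single m]
  · simp only [G]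
    rw [integral_const_mul, integral_exp_mul_laguerre_mul_laguerre, if_pos rfl]
    have : (Real.pi : ℂ) ≠ 0 := Complex.ofReal_ne_zero.2 Real.pi_ne_zero
    push_cast
    field_simp
  · intro n hn
    simp only [G]
    rw [integral_const_mul, integral_exp_mul_laguerre_mul_laguerre, if_neg hn.symm, mul_zero]

/-! ### Number-diagonal states -/

theorem numberDiag_apply_eq (p : PMF ℕ) (n : ℕ) :
    numberDiag p n n = (((p n).toReal : ℝ) : ℂ) := Matrix.diagonal_apply_eq _ n

theorem numberDiag_apply_ne (p : PMF ℕ) {m n : ℕ} (h : m ≠ n) : numberDiag p m n = 0 :=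
  Matrix.diagonal_apply_ne _ h

theorem isDensity_numberDiag (p : PMF ℕ) : IsDensity (numberDiag p) := by
  refine ⟨Matrix.PosSemidef.diagonal fun n => ?_, ?_⟩
  · exact Complex.zero_le_real.2 ENNReal.toReal_nonneg
  · simp only [numberDiag_apply_eq]
    have h := Complex.hasSum_ofReal.2 (hasSum_toReal_pmf p)
    rwa [Complex.ofReal_one] at h

theorem isDiag_numberDiag (p : PMF ℕ) : (numberDiag p).IsDiag := Matrix.isDiag_diagonal _

theorem husimi_numberDiag (p : PMF ℕ) : husimi (numberDiag p) = transform p := by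
  funext r
  rw [husimi, tsum_husimiTerm_of_isDiag (isDiag_numberDiag p)]
  simp_rw [husimiTerm_diag_eq fun k => (isDensity_numberDiag p).1.diag_nonneg]
  rw [← Complex.ofReal_tsum, Complex.ofReal_re, transform]
  congr 1
  refine tsum_congr fun n => ?_
  rw [norm_coherent_sq, numberDiag_apply_eq, Complex.ofReal_re]

theorem IsDensity.exists_eq_numberDiag {ρ : Matrix ℕ ℕ ℂ} (h : IsDensity ρ) (hd : ρ.IsDiag) :
    ∃ p : PMF ℕ, ρ = numberDiag p := by
  have hs : HasSum (fun n => ENNReal.ofReal (ρ n n).re) 1 := by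
    rw [← ENNReal.ofReal_one, ← h.hasSum_re.tsum_eq,
      ENNReal.ofReal_tsum_of_nonneg h.diag_re_nonneg h.hasSum_re.summable]
    exact ENNReal.summable.hasSum
  obtain ⟨p, hp⟩ : ∃ p : PMF ℕ, ∀ n, p n = ENNReal.ofReal (ρ n n).re :=
    ⟨⟨_, hs⟩, fun _ => rfl⟩
  refine ⟨p, Matrix.ext fun i j => ?_⟩
  by_cases hij : i = j
  · subst hij
    rw [numberDiag_apply_eq, hp, ENNReal.toReal_ofReal (h.diag_re_nonneg i)]
    exact h.diag_eq_re i
  · rw [hd hij, numberDiag_apply_ne _ hij]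

/-- The output of number-diagonal inputs is number-diagonal. -/
theorem isDiag_output (η : ℝ) {ρX ρY : Matrix ℕ ℕ ℂ} (hX : ρX.IsDiag) (hY : ρY.IsDiag) :
    (output η ρX ρY).IsDiag := by
  intro j j' hj
  rw [output, partialTrace]
  refine (tsum_congr fun k => ?_).trans tsum_zero
  rw [jointOutput_apply]
  refine Finset.sum_eq_zero fun c _ => Finset.sum_eq_zero fun d _ => ?_
  by_cases hcd : c = d
  · subst hcd
    -- With the same traced index `k` and `j ≠ j'`, the two total photon numbers differ, so at least
    -- one beamsplitter factor vanishes.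
    by_cases hc : j + k = c.1 + c.2
    · rw [bsMatrix_eq_zero η (a := (j', k)) (b := c) (by dsimp only; omega), mul_zero]
    · rw [bsMatrix_eq_zero η (a := (j, k)) (b := c) hc, zero_mul, zero_mul]
  · have : (ρX ⊗ₖ ρY) c d = 0 := (hX.kronecker hY) hcd
    rw [this, mul_zero, zero_mul]

theorem measurable_transform (p : PMF ℕ) : Measurable (transform p) := by
  rw [← husimi_numberDiag]
  exact (isDensity_numberDiag p).measurable_husimi

theorem transform_nonneg (p : PMF ℕ) (r : ℂ) : 0 ≤ transform p r := by
  rw [← husimi_numberDiag]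
  exact (isDensity_numberDiag p).husimi_nonneg r

/-- A Radon–Nikodym derivative is determined only almost everywhere, but the inner integral ignores
null sets, so the integrands agree at every `s`. -/
theorem invIntegrand_scaledAddDensity {η : ℝ} {f g h : ℂ → ℝ} (hm : Measurable h)
    (h0 : ∀ r, 0 ≤ h r) (hl : lawOf h = scaledAddLaw η (lawOf f) (lawOf g)) (n : ℕ) :
    invIntegrand (scaledAddDensity η f g) n = invIntegrand h n := by
  have hae : scaledAddDensity η f g =ᵐ[volume] h := by
    unfold scaledAddDensity
    rw [← hl, lawOf]
    filter_upwards [Measure.rnDeriv_withDensity volume (ENNReal.measurable_ofReal.comp hm)]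
      with r hr
    simp only [Function.comp_def] at hr
    rw [hr, ENNReal.toReal_ofReal (h0 r)]
  funext s
  rw [invIntegrand, invIntegrand, charFn, charFn]
  congr 1
  refine integral_congr_ae ?_
  filter_upwards [hae] with r hr
  rw [hr]

/-- Mixing number-diagonal states realises the scaled addition of their distributions. -/
theorem exists_output_numberDiag {η : ℝ} (h0 : 0 < η) (h1 : η < 1) (pX pY : PMF ℕ) :
    ∃ pZ : PMF ℕ, output η (numberDiag pX) (numberDiag pY) = numberDiag pZ ∧
      (∀ n, Integrable
        (invIntegrand (scaledAddDensity η (transform pX) (transform pY)) n) volume) ∧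
      (∀ n, boxplus η pX pY n = (((pZ n).toReal : ℝ) : ℂ)) ∧
      lawOf (transform pZ) = scaledAddLaw η (lawOf (transform pX)) (lawOf (transform pY)) := by
  have hX := isDensity_numberDiag pX
  have hY := isDensity_numberDiag pY
  -- The p.m.f. is read off the diagonal of the output state, so its transform is the output Husimi
  -- function and the convolution formula applies.
  obtain ⟨pZ, hZ⟩ := (hX.output h0.le h1.le hY).exists_eq_numberDiag
    (isDiag_output η (isDiag_numberDiag pX) (isDiag_numberDiag pY))
  have hl : lawOf (transform pZ) =
      scaledAddLaw η (lawOf (transform pX)) (lawOf (transform pY)) := by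
    rw [← husimi_numberDiag, ← hZ, husimi_output h0 h1 hX hY, husimi_numberDiag,
      husimi_numberDiag]
    refine lawOf_eq_scaledAddLaw h0 h1 (measurable_transform pX) (measurable_transform pY)
      (transform_nonneg pX) (transform_nonneg pY) ?_
    rw [← husimi_numberDiag, ← husimi_numberDiag]
    exact convolutionExists_husimi h0 h1 hX hY
  have hinv := invIntegrand_scaledAddDensity (measurable_transform pZ) (transform_nonneg pZ) hl
  refine ⟨pZ, hZ, fun n => ?_, fun n => ?_, hl⟩
  · rw [hinv]
    exact (invTransform_transform pZ n).1
  · rw [boxplus, invTransform, hinv]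
    exact (invTransform_transform pZ n).2

end NumberMixing

theorem mainTheorem4 (η : ℝ) (hη0 : 0 < η) (hη1 : η < 1) :
    -- the output of number-diagonal inputs is number-diagonal, with distribution `X ⊞_η Y`
    (∀ pX pY : PMF ℕ, ∃ pZ : PMF ℕ,
      output η (numberDiag pX) (numberDiag pY) = numberDiag pZ ∧
      (∀ n, Integrable
        (invIntegrand (scaledAddDensity η (transform pX) (transform pY)) n) volume) ∧
      (∀ n, boxplus η pX pY n = (((pZ n).toReal : ℝ) : ℂ)) ∧
      lawOf (transform pZ) = scaledAddLaw η (lawOf (transform pX)) (lawOf (transform pY))) ∧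
    -- the beamsplitter is unitary, and its output mode is `U† x U = √η x + √(1 - η) y`
    (imul (bsMatrix η)ᴴ (bsMatrix η) = 1 ∧ imul (bsMatrix η) (bsMatrix η)ᴴ = 1 ∧
      annX * beamsplitter η =
        beamsplitter η * (((√η : ℝ) : ℂ) • annX + ((√(1 - η) : ℝ) : ℂ) • annY)) ∧
    -- `𝒯(X)` is the Husimi function of the number-diagonal state, and `𝒯⁻¹` inverts `𝒯`
    (∀ p : PMF ℕ, IsDensity (numberDiag p) ∧ husimi (numberDiag p) = transform p ∧
      (∀ n, Integrable (invIntegrand (transform p) n) volume) ∧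
      ∀ n, invTransform (transform p) n = (((p n).toReal : ℝ) : ℂ)) ∧
    -- Husimi functions are well-defined p.d.f.s; circular symmetry means number-diagonal
    (∀ ρ : Matrix ℕ ℕ ℂ, IsDensity ρ →
      (∀ r, HasSum (husimiTerm ρ r) (((Real.pi * husimi ρ r : ℝ)) : ℂ)) ∧
      (∀ r, 0 ≤ husimi ρ r) ∧ Integrable (husimi ρ) volume ∧ (∫ r, husimi ρ r) = 1 ∧
      (CircularlySymmetric (husimi ρ) ↔ ρ.IsDiag)) ∧
    -- for arbitrary inputs the output is a state, and Husimi functions combine by convolution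
    (∀ ρX ρY : Matrix ℕ ℕ ℂ, IsDensity ρX → IsDensity ρY →
      IsDensity (jointOutput η ρX ρY) ∧ IsDensity (output η ρX ρY) ∧
      ConvolutionExists (scaleDensity η (husimi ρX)) (scaleDensity (1 - η) (husimi ρY))
        (ContinuousLinearMap.mul ℝ ℝ) volume ∧
      husimi (output η ρX ρY) =
        scaleDensity η (husimi ρX) ⋆[ContinuousLinearMap.mul ℝ ℝ, volume]
          scaleDensity (1 - η) (husimi ρY)) := by
  refine ⟨exists_output_numberDiag hη0 hη1,
    ⟨imul_conjTranspose_bsMatrix_bsMatrix hη0.le hη1.le,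
      imul_bsMatrix_conjTranspose_bsMatrix hη0.le hη1.le, annX_mul_beamsplitter η⟩,
    fun p => ⟨isDensity_numberDiag p, husimi_numberDiag p,
      fun n => (invTransform_transform p n).1, fun n => (invTransform_transform p n).2⟩,
    fun ρ h => ⟨h.hasSum_husimiTerm, h.husimi_nonneg, h.integrable_husimi, h.integral_husimi,
      h.circularlySymmetric_iff⟩,
    fun ρX ρY hX hY => ⟨hX.jointOutput hη0.le hη1.le hY, hX.output hη0.le hη1.le hY,
      convolutionExists_husimi hη0 hη1 hX hY, husimi_output hη0 hη1 hX hY⟩⟩
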